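/- Let $k\ge 1$ and let $\mathbf e=(e_1,\dots,e_k)\in\mathbb Z^k$ be a nonzero vector with $e_m\ge 0$ for all $m$; put $e_m:=0$ for $m>k$. Let the numbers $p(n)_{\mathbf e}$ be defined by the formal power series identity $$\sum_{n=0}^{\infty}p(n)_{\mathbf e}\,q^n=\prod_{m=1}^{k}\prod_{n=1}^{\infty}\frac{1}{(1-q^{mn})^{e_m}} .$$ Let $d:=\gcd\{m: e_m\neq 0\}$ and define $$\gamma:=\sum_{1\le n\le k/d}e_{dn},\qquad \delta:=\sum_{1\le n\le k/d}\frac{e_{dn}}{n},\qquad \lambda:=\prod_{m=1}^{k}\left(\frac{m}{2\pi}\right)^{e_{dm}/2},\qquad A:=\frac{\pi^2\delta}{6}.$$ Then, as $n\to\infty$ through the positive integers, $$p(dn)_{\mathbf e}\sim\frac{\lambda\,A^{(1+\gamma)/4}}{2\sqrt{\pi}\;n^{(3+\gamma)/4}}\;e^{2\sqrt{An}},$$ that is, the ratio of the two sides tends to $1$. -/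

import Mathlib

open scoped PowerSeries PowerSeries.WithPiTopology

noncomputable section

namespace GenPartition

/-- For `r ≥ 1` the formal power series `1 - q ^ r` is invertible in `ℤ⟦q⟧`. -/
theorem isUnit_one_sub_X_pow (r : ℕ) (hr : r ≠ 0) :
    IsUnit (1 - PowerSeries.X ^ r : ℤ⟦X⟧) := by
  rw [PowerSeries.isUnit_iff_constantCoeff]
  simp [hr]

/-- The formal power series `1 - q ^ r` (`r ≥ 1`) as a unit of `ℤ⟦q⟧`, so that it has integer
powers. -/
def oneSubXPow (r : ℕ) (hr : r ≠ 0) : ℤ⟦X⟧ˣ :=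
  (isUnit_one_sub_X_pow r hr).unit

/-- The factor `1 / (1 - q ^ (m * n)) ^ a` with `m = i + 1`, `n = j + 1` and `a : ℤ`. -/
def factor (a : ℤ) (i j : ℕ) : ℤ⟦X⟧ :=
  ((oneSubXPow ((i + 1) * (j + 1)) (by positivity) ^ (-a) : ℤ⟦X⟧ˣ) : ℤ⟦X⟧)

/-- The generating function `∏_{m = 1}^{k} ∏_{n ≥ 1} 1 / (1 - q ^ (m * n)) ^ (e_m)` of an integer
vector `e = (e_1, …, e_k)`; the entry `e_m` is `e i` with `m = i + 1`. The infinite product is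
taken in the topology of coefficientwise convergence. -/
def genFun {k : ℕ} (e : Fin k → ℤ) : ℤ⟦X⟧ :=
  ∏ i : Fin k, ∏' j : ℕ, factor (e i) i j

/-- The infinite products in `genFun` converge. -/
theorem multipliable_factor (a : ℤ) (i : ℕ) : Multipliable fun j : ℕ => factor a i j := by
  have key : ∀ j : ℕ, (PowerSeries.X ^ ((i + 1) * (j + 1)) : ℤ⟦X⟧) ∣ factor a i j - 1 := by
    intro j
    set r := (i + 1) * (j + 1)
    have hr : r ≠ 0 := by positivity
    let φ := Ideal.Quotient.mk (Ideal.span {(PowerSeries.X ^ r : ℤ⟦X⟧)})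
    have hX : φ (PowerSeries.X ^ r) = 0 :=
      Ideal.Quotient.eq_zero_iff_mem.mpr (Ideal.mem_span_singleton_self _)
    have hu : Units.map φ.toMonoidHom (oneSubXPow r hr) = 1 := by
      ext
      change φ (1 - PowerSeries.X ^ r) = 1
      rw [map_sub, hX, map_one, sub_zero]
    have hz : φ (factor a i j) = 1 := by
      have h1 : Units.map φ.toMonoidHom (oneSubXPow r hr ^ (-a)) = 1 := by
        rw [map_zpow, hu, one_zpow]
      exact congrArg Units.val h1
    rw [← Ideal.mem_span_singleton, ← Ideal.Quotient.eq_zero_iff_mem]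
    change φ (factor a i j - 1) = 0
    rw [map_sub, hz, map_one, sub_self]
  have h : Multipliable fun j : ℕ => 1 + (factor a i j - 1) := by
    apply PowerSeries.WithPiTopology.multipliable_one_add_of_tendsto_order_atTop_nhds_top
    refine ENat.tendsto_nhds_top_iff_natCast_lt.mpr
      (fun n => Filter.eventually_atTop.mpr ⟨n, fun j hj => ?_⟩)
    have h1 : (((i + 1) * (j + 1) : ℕ) : ℕ∞) ≤ (factor a i j - 1).order := by
      refine PowerSeries.nat_le_order _ _ fun l hl => ?_
      exact PowerSeries.X_pow_dvd_iff.mp (key j) l hl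
    refine lt_of_lt_of_le ?_ h1
    norm_cast
    nlinarith
  simpa using h

/-- The generalized partition function `p(n)_e`: the coefficient of `q ^ n` in `genFun e`. -/
def p {k : ℕ} (e : Fin k → ℤ) (n : ℕ) : ℤ :=
  PowerSeries.coeff n (genFun e)

/-- The entry `e_m` of `e = (e_1, …, e_k)`, with `e_m = 0` for `m` outside `1, …, k`. -/
def entry {k : ℕ} (e : Fin k → ℤ) (m : ℕ) : ℤ :=
  if h : 1 ≤ m ∧ m ≤ k then e ⟨m - 1, by omega⟩ else 0

/-- `d = gcd {m : e_m ≠ 0}`. -/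
def d {k : ℕ} (e : Fin k → ℤ) : ℕ :=
  ((Finset.Icc 1 k).filter fun m => entry e m ≠ 0).gcd id

/-- `γ = ∑_{n = 1}^{k / d} e_{dn}`. -/
def gamma {k : ℕ} (e : Fin k → ℤ) : ℝ :=
  ∑ n ∈ Finset.Icc 1 (k / d e), (entry e (d e * n) : ℝ)

/-- `δ = ∑_{n = 1}^{k / d} e_{dn} / n`. -/
def delta {k : ℕ} (e : Fin k → ℤ) : ℝ :=
  ∑ n ∈ Finset.Icc 1 (k / d e), (entry e (d e * n) : ℝ) / (n : ℝ)

/-- `λ = ∏_{m = 1}^{k} (m / (2π)) ^ (e_{dm} / 2)`. -/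
def lam {k : ℕ} (e : Fin k → ℤ) : ℝ :=
  ∏ m ∈ Finset.Icc 1 k, ((m : ℝ) / (2 * Real.pi)) ^ ((entry e (d e * m) : ℝ) / 2)

/-- `A = π² δ / 6`. -/
def A {k : ℕ} (e : Fin k → ℤ) : ℝ :=
  Real.pi ^ 2 * delta e / 6

end GenPartition

end

/-! With P(q) = ∏ (1 - q^n)⁻¹, the generating function is ∏ P(q^m)^(e_m). It is a series in q^d, so
replacing q^d by q reduces the claim to coprime dilations n with exponents e_{dn} (`hasSum_p_mul`,
`gcd_reducedSupp`). Call the reduced function G. Its n-th coefficient is an integral of G(e^(-z))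
e^(nz) over z = t + iθ, |θ| ≤ π, for any t > 0 (`integral_eq_coeff`).

Near z = 0 the inversion formula of the eta function gives P(e^(-rz)) ~ (rz/2π)^(1/2) e^(π²/(6rz)),
uniformly in a sector (`tendsto_inv_eulerProd_div`). Multiplying over the dilations, G(e^(-z)) ~ λ
z^(γ/2) e^(A/z). The exponent A/z + nz has its saddle at t = √(A/n). On the scale θ = t √(t/A) u the
integrand becomes a constant times a function tending to e^(-u²), and the arc |θ| ≤ t yields the
main term (`tendsto_saddle_central`).

The rest of the circle is negligible. Comparing the logarithms of P(q) and P(|q|) termwise shows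
that |P(q)| is smaller than P(|q|) by a factor e^(-c/t) unless q is close to 1. By Bézout, coprime
dilations cannot all bring q^m close to 1 when t ≤ |θ| ≤ π (`exists_mul_le_abs_sin`,
`norm_expGenFun_le`). -/

section

open Filter Topology Finset

namespace GenPartition

/-! ### Euler product; formal series with nonnegative coefficients and their sums -/

/-- The Euler product `∏ (1 - q ^ n)` over `n ≥ 1`. -/
noncomputable def eulerProd (q : ℂ) : ℂ := ∏' n : ℕ, (1 - q ^ (n + 1))

theorem one_sub_pow_ne_zero {q : ℂ} (hq : ‖q‖ < 1) (n : ℕ) : 1 - q ^ (n + 1) ≠ 0 := by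
  refine sub_ne_zero.mpr fun h => ?_
  have := pow_lt_one₀ (norm_nonneg q) hq n.succ_ne_zero
  rw [← norm_pow, Nat.succ_eq_add_one, ← h, norm_one] at this
  exact lt_irrefl _ this

theorem summable_norm_pow_succ {q : ℂ} (hq : ‖q‖ < 1) : Summable fun n : ℕ => ‖q ^ (n + 1)‖ := by
  simpa using (summable_nat_add_iff 1).mpr (summable_geometric_of_lt_one (norm_nonneg q) hq)

theorem eulerProd_ne_zero {q : ℂ} (hq : ‖q‖ < 1) : eulerProd q ≠ 0 := by
  refine tprod_one_add_ne_zero_of_summable (f := fun n => -q ^ (n + 1)) (fun n => ?_) ?_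
  · simpa only [← sub_eq_add_neg] using one_sub_pow_ne_zero hq n
  · simpa using summable_norm_pow_succ hq

/-- The power series `f` has nonnegative coefficients, supported on the multiples of `d`, and sums
to `g` on the open unit disc. -/
structure HasNonnegExpansion (d : ℕ) (f : ℤ⟦X⟧) (g : ℂ → ℂ) : Prop where
  coeff_nonneg : ∀ n, 0 ≤ PowerSeries.coeff n f
  coeff_eq_zero : ∀ n, ¬ d ∣ n → PowerSeries.coeff n f = 0
  hasSum : ∀ q : ℂ, ‖q‖ < 1 → HasSum (fun n => ((PowerSeries.coeff n f : ℤ) : ℂ) * q ^ n) (g q)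

namespace HasNonnegExpansion

variable {d : ℕ} {f f' : ℤ⟦X⟧} {g g' : ℂ → ℂ}

theorem one : HasNonnegExpansion d 1 fun _ => 1 where
  coeff_nonneg n := by rw [PowerSeries.coeff_one]; split_ifs <;> simp
  coeff_eq_zero n hn := by
    rw [PowerSeries.coeff_one, if_neg]
    rintro rfl
    exact hn (dvd_zero d)
  hasSum q _ := by
    convert! hasSum_single (f := fun n => ((PowerSeries.coeff n (1 : ℤ⟦X⟧) : ℤ) : ℂ) * q ^ n) 0 ?_ using 1
    · simp
    · intro n hn
      simp [PowerSeries.coeff_one, hn]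

theorem mul (h : HasNonnegExpansion d f g) (h' : HasNonnegExpansion d f' g') :
    HasNonnegExpansion d (f * f') fun q => g q * g' q where
  coeff_nonneg n := by
    rw [PowerSeries.coeff_mul]
    exact Finset.sum_nonneg fun x _ => mul_nonneg (h.coeff_nonneg _) (h'.coeff_nonneg _)
  coeff_eq_zero n hn := by
    rw [PowerSeries.coeff_mul]
    refine Finset.sum_eq_zero fun x hx => ?_
    by_cases h1 : d ∣ x.1
    · rw [h'.coeff_eq_zero x.2, mul_zero]
      intro h2
      exact hn (mem_antidiagonal.mp hx ▸ dvd_add h1 h2)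
    · rw [h.coeff_eq_zero _ h1, zero_mul]
  hasSum q hq := by
    have h1 := (h.hasSum q hq).summable.norm
    have h2 := (h'.hasSum q hq).summable.norm
    have h3 := (summable_norm_sum_mul_antidiagonal_of_summable_norm h1 h2).of_norm.hasSum
    rw [← tsum_mul_tsum_eq_tsum_sum_antidiagonal_of_summable_norm h1 h2, (h.hasSum q hq).tsum_eq,
      (h'.hasSum q hq).tsum_eq] at h3
    refine h3.congr_fun fun n => ?_
    rw [PowerSeries.coeff_mul, Int.cast_sum, Finset.sum_mul]
    refine Finset.sum_congr rfl fun x hx => ?_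
    rw [← mem_antidiagonal.mp hx, pow_add]
    push_cast
    ring

theorem pow (h : HasNonnegExpansion d f g) (n : ℕ) :
    HasNonnegExpansion d (f ^ n) fun q => g q ^ n := by
  induction n with
  | zero => simpa using one
  | succ n ih => simpa only [pow_succ] using ih.mul h

theorem prod {ι : Type*} (s : Finset ι) {f : ι → ℤ⟦X⟧} {g : ι → ℂ → ℂ}
    (h : ∀ i ∈ s, HasNonnegExpansion d (f i) (g i)) :
    HasNonnegExpansion d (∏ i ∈ s, f i) fun q => ∏ i ∈ s, g i q := by
  classical
  induction s using Finset.induction_on with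
  | empty => simpa using one
  | insert i s hi ih =>
    simp only [Finset.prod_insert hi]
    exact (h i (mem_insert_self i s)).mul (ih fun j hj => h j (mem_insert_of_mem hj))

theorem coeff_le_coeff_mul (h : HasNonnegExpansion d f g) (h' : HasNonnegExpansion d f' g')
    (h0 : PowerSeries.constantCoeff f' = 1) (n : ℕ) :
    PowerSeries.coeff n f ≤ PowerSeries.coeff n (f * f') := by
  rw [PowerSeries.coeff_mul]
  have := Finset.single_le_sum (f := fun x : ℕ × ℕ =>
    PowerSeries.coeff x.1 f * PowerSeries.coeff x.2 f') (s := antidiagonal n)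
    (fun x _ => mul_nonneg (h.coeff_nonneg _) (h'.coeff_nonneg _)) (a := (n, 0)) (by simp)
  simpa [h0] using this

/-- An infinite product of expansions with constant coefficient `1` which converges formally and
pointwise is again an expansion. -/
theorem tprod {f : ℕ → ℤ⟦X⟧} {g : ℕ → ℂ → ℂ} {G : ℂ → ℂ}
    (h : ∀ j, HasNonnegExpansion d (f j) (g j)) (h0 : ∀ j, PowerSeries.constantCoeff (f j) = 1)
    (hf : Multipliable f)
    (hg : ∀ q : ℂ, ‖q‖ < 1 → Tendsto (fun J => ∏ j ∈ range J, g j q) atTop (𝓝 (G q))) :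
    HasNonnegExpansion d (∏' j, f j) G := by
  set P : ℕ → ℤ⟦X⟧ := fun J => ∏ j ∈ range J, f j with hP
  have hPJ : ∀ J, HasNonnegExpansion d (P J) fun q => ∏ j ∈ range J, g j q :=
    fun J => prod _ fun j _ => h j
  have hlim : ∀ n, Tendsto (fun J => PowerSeries.coeff n (P J)) atTop
      (𝓝 (PowerSeries.coeff n (∏' j, f j))) := fun n =>
    ((PowerSeries.WithPiTopology.continuous_coeff ℤ n).tendsto _).comp hf.hasProd.tendsto_prod_nat
  -- Each new factor has nonnegative coefficients and constant term 1, so the coefficients of the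
  -- partial products increase to those of the limit, which therefore serves as a majorant.
  have hmono : ∀ n, Monotone fun J => PowerSeries.coeff n (P J) := fun n =>
    monotone_nat_of_le_succ fun J => by
      simp only [hP, prod_range_succ]
      exact (hPJ J).coeff_le_coeff_mul (h J) (h0 J) n
  have hle : ∀ n J, PowerSeries.coeff n (P J) ≤ PowerSeries.coeff n (∏' j, f j) :=
    fun n J => (hmono n).ge_of_tendsto (hlim n) J
  have hnn : ∀ n, 0 ≤ PowerSeries.coeff n (∏' j, f j) := fun n =>
    ((hPJ 0).coeff_nonneg n).trans (hle n 0)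
  have hlimR : ∀ n, Tendsto (fun J => ((PowerSeries.coeff n (P J) : ℤ) : ℝ)) atTop
      (𝓝 ((PowerSeries.coeff n (∏' j, f j) : ℤ) : ℝ)) := fun n =>
    (continuous_of_discreteTopology (f := fun m : ℤ => (m : ℝ))).continuousAt.tendsto.comp (hlim n)
  have hlimC : ∀ n, Tendsto (fun J => ((PowerSeries.coeff n (P J) : ℤ) : ℂ)) atTop
      (𝓝 ((PowerSeries.coeff n (∏' j, f j) : ℤ) : ℂ)) := fun n =>
    (continuous_of_discreteTopology (f := fun m : ℤ => (m : ℂ))).continuousAt.tendsto.comp (hlim n)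
  refine ⟨hnn, fun n hn => ?_, fun q hq => ?_⟩
  · refine tendsto_nhds_unique (hlim n) ?_
    simp only [(hPJ _).coeff_eq_zero n hn]
    exact tendsto_const_nhds
  · have hx : ‖((‖q‖ : ℝ) : ℂ)‖ < 1 := by simpa using hq
    have hre : ∀ J, HasSum (fun n => ((PowerSeries.coeff n (P J) : ℤ) : ℝ) * ‖q‖ ^ n)
        (∏ j ∈ range J, g j (‖q‖ : ℝ)).re := fun J => by
      refine (Complex.hasSum_re ((hPJ J).hasSum _ hx)).congr_fun fun n => ?_
      rw [← Complex.ofReal_pow, ← Complex.ofReal_intCast, ← Complex.ofReal_mul, Complex.ofReal_re]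
    -- At the point |q| every partial sum of the limit series is a limit in J of partial sums for `P
    -- J`, each at most the full value, and these values tend to G(|q|).
    have hsum : Summable fun n => ((PowerSeries.coeff n (∏' j, f j) : ℤ) : ℝ) * ‖q‖ ^ n := by
      refine summable_of_sum_range_le (c := (G (‖q‖ : ℝ)).re)
        (fun n => mul_nonneg (by exact_mod_cast hnn n) (by positivity)) fun N => ?_
      refine le_of_tendsto_of_tendsto
        (tendsto_finsetSum (range N) fun n _ => (hlimR n).mul_const (‖q‖ ^ n))
        ((Complex.continuous_re.tendsto _).comp (hg _ hx)) (Eventually.of_forall fun J => ?_)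
      exact sum_le_hasSum _ (fun n _ => mul_nonneg (by exact_mod_cast (hPJ J).coeff_nonneg n)
        (by positivity)) (hre J)
    have hnorm : ∀ n, ‖((PowerSeries.coeff n (∏' j, f j) : ℤ) : ℂ) * q ^ n‖ =
        ((PowerSeries.coeff n (∏' j, f j) : ℤ) : ℝ) * ‖q‖ ^ n := fun n => by
      rw [norm_mul, norm_pow, Complex.norm_intCast, abs_of_nonneg (by exact_mod_cast hnn n)]
    have hsC : Summable fun n => ((PowerSeries.coeff n (∏' j, f j) : ℤ) : ℂ) * q ^ n :=
      Summable.of_norm (hsum.congr fun n => (hnorm n).symm)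
    have hT : Tendsto (fun J => ∑' n, ((PowerSeries.coeff n (P J) : ℤ) : ℂ) * q ^ n) atTop
        (𝓝 (∑' n, ((PowerSeries.coeff n (∏' j, f j) : ℤ) : ℂ) * q ^ n)) := by
      refine tendsto_tsum_of_dominated_convergence hsum
        (fun n => (hlimC n).mul_const _) (Eventually.of_forall fun J n => ?_)
      rw [norm_mul, norm_pow, Complex.norm_intCast,
        abs_of_nonneg (by exact_mod_cast (hPJ J).coeff_nonneg n)]
      have : ((PowerSeries.coeff n (P J) : ℤ) : ℝ) ≤ PowerSeries.coeff n (∏' j, f j) := by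
        exact_mod_cast hle n J
      gcongr
    have hT' : Tendsto (fun J => ∑' n, ((PowerSeries.coeff n (P J) : ℤ) : ℂ) * q ^ n) atTop
        (𝓝 (G q)) := (hg q hq).congr fun J => ((hPJ J).hasSum q hq).tsum_eq.symm
    rw [tendsto_nhds_unique hT' hT]
    exact hsC.hasSum

end HasNonnegExpansion

/-! ### Analytic form of the generating function -/

theorem oneSubXPow_inv_eq (r : ℕ) (hr : r ≠ 0) :
    (((oneSubXPow r hr)⁻¹ : ℤ⟦X⟧ˣ) : ℤ⟦X⟧) = PowerSeries.mk fun n => if r ∣ n then 1 else 0 := by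
  refine Units.inv_eq_of_mul_eq_one_right (u := oneSubXPow r hr) ?_
  change (1 - PowerSeries.X ^ r) * _ = _
  ext n
  rw [sub_mul, one_mul, map_sub, PowerSeries.coeff_X_pow_mul', PowerSeries.coeff_mk,
    PowerSeries.coeff_one]
  rcases Nat.lt_or_ge n r with h | h
  · rw [if_neg h.not_ge, sub_zero]
    rcases eq_or_ne n 0 with rfl | h0
    · simp
    · rw [if_neg (Nat.not_dvd_of_pos_of_lt (Nat.pos_of_ne_zero h0) h), if_neg h0]
  · rw [if_pos h, PowerSeries.coeff_mk, if_neg (by omega : n ≠ 0)]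
    have h' : r ∣ n - r ↔ r ∣ n := by
      conv_rhs => rw [← Nat.sub_add_cancel h]
      exact (Nat.dvd_add_left (dvd_refl r)).symm
    simp only [h', sub_self]

theorem hasNonnegExpansion_oneSubXPow_inv {d r : ℕ} (hr : r ≠ 0) (hd : d ∣ r) :
    HasNonnegExpansion d (((oneSubXPow r hr)⁻¹ : ℤ⟦X⟧ˣ) : ℤ⟦X⟧) fun q => (1 - q ^ r)⁻¹ := by
  rw [oneSubXPow_inv_eq]
  refine ⟨fun n => ?_, fun n hn => ?_, fun q hq => ?_⟩
  · rw [PowerSeries.coeff_mk]; split_ifs <;> simp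
  · rw [PowerSeries.coeff_mk, if_neg fun h => hn (hd.trans h)]
  · have hq' : ‖q ^ r‖ < 1 := by
      rw [norm_pow]; exact pow_lt_one₀ (norm_nonneg q) hq hr
    have hinj : Function.Injective fun n : ℕ => r * n := mul_right_injective₀ hr
    rw [← hinj.hasSum_iff]
    · refine (hasSum_geometric_of_norm_lt_one hq').congr_fun fun n => ?_
      simp [pow_mul]
    · intro n hn
      rw [PowerSeries.coeff_mk, if_neg]
      · simp
      · rintro ⟨m, rfl⟩
        exact hn ⟨m, rfl⟩

theorem factor_natCast (a i j : ℕ) : factor a i j =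
    (((oneSubXPow ((i + 1) * (j + 1)) (by positivity))⁻¹ : ℤ⟦X⟧ˣ) : ℤ⟦X⟧) ^ a := by
  simp [factor]

theorem hasNonnegExpansion_tprod_factor {d i a : ℕ} (hd : a ≠ 0 → d ∣ i + 1) :
    HasNonnegExpansion d (∏' j, factor a i j) fun q => (eulerProd (q ^ (i + 1)))⁻¹ ^ a := by
  -- For a = 0 nothing is known about d ∣ i + 1, but every factor is 1.
  rcases eq_or_ne a 0 with rfl | ha
  · simpa [factor] using HasNonnegExpansion.one
  refine HasNonnegExpansion.tprod (g := fun j q => (1 - q ^ ((i + 1) * (j + 1)))⁻¹ ^ a)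
    (fun j => ?_) (fun j => ?_) (multipliable_factor a i) fun q hq => ?_
  · rw [factor_natCast]
    exact (hasNonnegExpansion_oneSubXPow_inv (by positivity) (dvd_mul_of_dvd_left (hd ha) _)).pow a
  · rw [factor_natCast, oneSubXPow_inv_eq, map_pow, ← PowerSeries.coeff_zero_eq_constantCoeff_apply,
      PowerSeries.coeff_mk]
    simp
  · have hq' : ‖q ^ (i + 1)‖ < 1 := by
      rw [norm_pow]; exact pow_lt_one₀ (norm_nonneg q) hq (by positivity)
    have h := (ModularForm.multipliable_one_sub_pow hq').hasProd.tendsto_prod_nat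
    refine ((h.inv₀ (eulerProd_ne_zero hq')).pow a).congr fun J => ?_
    rw [← Finset.prod_inv_distrib, ← Finset.prod_pow]
    simp only [pow_mul]

theorem hasNonnegExpansion_genFun {k : ℕ} (d : ℕ) (a : Fin k → ℕ)
    (hd : ∀ i, a i ≠ 0 → d ∣ (i : ℕ) + 1) :
    HasNonnegExpansion d (genFun fun i => (a i : ℤ)) fun q =>
      ∏ i : Fin k, (eulerProd (q ^ ((i : ℕ) + 1)))⁻¹ ^ a i :=
  HasNonnegExpansion.prod _ fun i _ => hasNonnegExpansion_tprod_factor (hd i)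

/-! ### Eta inversion and behaviour near q = 1 -/

theorem eta_eq_eulerProd (τ : ℂ) : ModularForm.eta τ =
    Complex.exp (2 * Real.pi * Complex.I * τ / 24) *
      eulerProd (Complex.exp (2 * Real.pi * Complex.I * τ)) := by
  simp [ModularForm.eta, Function.Periodic.qParam, eulerProd, ModularForm.eta_q]

/-- Since |arg z| < π/2, adding arg I = π/2 stays within the principal range, so the logarithm is
additive. The factor √I cancels the constant in the inversion formula for eta. -/
theorem sqrt_I_mul {z : ℂ} (hz : 0 < z.re) {r : ℝ} (hr : 0 < r) :
    Complex.sqrt (Complex.I * (r * z)) =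
      Complex.sqrt Complex.I * (((r ^ (1 / 2 : ℝ) : ℝ) : ℂ) * z ^ (1 / 2 : ℂ)) := by
  have hz0 : z ≠ 0 := by rintro rfl; simp at hz
  have hr0 : (r : ℂ) ≠ 0 := by exact_mod_cast hr.ne'
  have hI : Complex.log (Complex.I * (r * z)) =
      Complex.log Complex.I + (Real.log r + Complex.log z) := by
    have harg := abs_lt.mp (Complex.abs_arg_lt_pi_div_two_iff.mpr (Or.inl hz))
    rw [← Complex.log_ofReal_mul hr hz0]
    refine Complex.log_mul Complex.I_ne_zero (mul_ne_zero hr0 hz0) ?_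
    rw [Complex.arg_I, Complex.arg_real_mul z hr]
    constructor <;> linarith
  rw [sqrt_eq_exp (mul_ne_zero Complex.I_ne_zero (mul_ne_zero hr0 hz0)),
    sqrt_eq_exp Complex.I_ne_zero, hI, Real.rpow_def_of_pos hr, Complex.ofReal_exp,
    Complex.cpow_def_of_ne_zero hz0, ← Complex.exp_add, ← Complex.exp_add]
  push_cast
  ring_nf

/-- The modular transformation of the Euler product. -/
theorem inv_eulerProd_exp_neg {z : ℂ} (hz : 0 < z.re) {r : ℝ} (hr : 0 < r) :
    (eulerProd (Complex.exp (-(r * z))))⁻¹ =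
      ((((r / (2 * Real.pi)) ^ (1 / 2 : ℝ) : ℝ) : ℂ) * z ^ (1 / 2 : ℂ) *
        Complex.exp (Real.pi ^ 2 / (6 * r * z))) *
      (Complex.exp (-(r * z) / 24) *
        (eulerProd (Complex.exp (-(4 * Real.pi ^ 2 / (r * z)))))⁻¹) := by
  have hz0 : z ≠ 0 := by rintro rfl; simp at hz
  have hr0 : (r : ℂ) ≠ 0 := by exact_mod_cast hr.ne'
  have hπ : (Real.pi : ℂ) ≠ 0 := by exact_mod_cast Real.pi_ne_zero
  have hs : 0 < r / (2 * Real.pi) := by positivity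
  -- With τ = irz/(2π), the nome e^(2πiτ) is e^(-rz), and -1/τ has nome e^(-4π²/(rz)).
  set τ : ℂ := Complex.I * ((r / (2 * Real.pi) : ℝ) * z) with hτ
  have him : 0 < τ.im := by
    rw [hτ, Complex.I_mul_im, Complex.re_ofReal_mul]
    positivity
  have h := ModularForm.eta_comp_eq_csqrt_I_inv him
  have h1 : 2 * (Real.pi : ℂ) * Complex.I * τ = -(r * z) := by
    rw [hτ]
    push_cast
    field_simp
    linear_combination Complex.I_sq
  have h2 : 2 * (Real.pi : ℂ) * Complex.I * (-1 / τ) = -(4 * Real.pi ^ 2 / (r * z)) := by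
    rw [hτ]
    push_cast
    field_simp
    norm_num
  have hI : Complex.sqrt Complex.I ≠ 0 := by
    rw [sqrt_eq_exp Complex.I_ne_zero]
    exact Complex.exp_ne_zero _
  simp only [Function.comp_apply, Pi.smul_apply, Pi.mul_apply, smul_eq_mul] at h
  rw [eta_eq_eulerProd, eta_eq_eulerProd, h1, h2, hτ, sqrt_I_mul hz hs, mul_assoc (Complex.sqrt _),
    inv_mul_cancel_left₀ hI] at h
  have hn1 : ‖Complex.exp (-(r * z))‖ < 1 := by
    rw [Complex.norm_exp, Real.exp_lt_one_iff, Complex.neg_re, Complex.re_ofReal_mul]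
    nlinarith [mul_pos hr hz]
  have hn2 : ‖Complex.exp (-(4 * Real.pi ^ 2 / (r * z)))‖ < 1 := by
    have h3 : 0 < (-1 / τ).im := by
      have := UpperHalfPlane.im_inv_neg_coe_pos ⟨τ, him⟩
      rwa [inv_neg, ← one_div, ← neg_div] at this
    rw [← h2]
    exact UpperHalfPlane.norm_exp_two_pi_I_lt_one ⟨_, h3⟩
  have hE1 := eulerProd_ne_zero hn1
  have hE2 := eulerProd_ne_zero hn2
  -- The main exponential is the inverse of the 24th-root prefactor of eta at -1/τ.
  have e1 : Complex.exp (Real.pi ^ 2 / (6 * r * z)) *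
      Complex.exp (-(4 * Real.pi ^ 2 / (r * z)) / 24) = 1 := by
    rw [← Complex.exp_add, Complex.exp_eq_one_iff]
    refine ⟨0, ?_⟩
    field_simp
    ring
  rw [← mul_assoc, ← div_eq_mul_inv, inv_eq_one_div, div_eq_div_iff hE1 hE2, one_mul]
  linear_combination (Complex.exp (Real.pi ^ 2 / (6 * r * z))) * h -
    eulerProd (Complex.exp (-(4 * Real.pi ^ 2 / (r * z)))) * e1

/-- The sector `|im z| ≤ re z` with its vertex removed. -/
def sector : Set ℂ := {z | 0 < z.re ∧ |z.im| ≤ z.re}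

theorem tendsto_re_sector : Tendsto Complex.re (𝓝[sector] 0) (𝓝[>] 0) := by
  refine tendsto_nhdsWithin_iff.mpr ⟨?_, ?_⟩
  · exact (Complex.continuous_re.tendsto 0).mono_left nhdsWithin_le_nhds
  · exact eventually_nhdsWithin_of_forall fun z hz => hz.1

/-- In the sector |z|² ≤ 2 (re z)², hence re (b/z) ≥ b / (2 re z), which tends to infinity. Applied
to the nome at -1/τ, this sends the transformed Euler product to 1. -/
theorem tendsto_exp_neg_div_sector {b : ℝ} (hb : 0 < b) :
    Tendsto (fun z : ℂ => Complex.exp (-(b / z))) (𝓝[sector] 0) (𝓝 0) := by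
  rw [tendsto_zero_iff_norm_tendsto_zero]
  have h : Tendsto (fun z : ℂ => Real.exp (-(b / 2 * z.re⁻¹))) (𝓝[sector] 0) (𝓝 0) :=
    Real.tendsto_exp_neg_atTop_nhds_zero.comp
      ((tendsto_inv_nhdsGT_zero.comp tendsto_re_sector).const_mul_atTop (half_pos hb))
  refine squeeze_zero' (Eventually.of_forall fun _ => norm_nonneg _) ?_ h
  refine eventually_nhdsWithin_of_forall fun z hz => ?_
  obtain ⟨h1, h2⟩ := hz
  rw [Complex.norm_exp, Real.exp_le_exp, Complex.neg_re, neg_le_neg_iff, div_eq_mul_inv (b : ℂ),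
    Complex.re_ofReal_mul, Complex.inv_re, Complex.normSq_apply]
  have h3 : z.im * z.im ≤ z.re * z.re := by
    rw [← abs_mul_abs_self z.im]
    exact mul_self_le_mul_self (abs_nonneg _) h2
  have h4 : z.re⁻¹ / 2 ≤ z.re / (z.re * z.re + z.im * z.im) := by
    have h5 : 0 < z.re * z.re + z.im * z.im :=
      add_pos_of_pos_of_nonneg (mul_pos h1 h1) (mul_self_nonneg _)
    rw [le_div_iff₀ h5]
    field_simp
    nlinarith
  nlinarith

theorem tendsto_eulerProd_zero : Tendsto eulerProd (𝓝 0) (𝓝 1) := by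
  have h := (ModularForm.differentiableOn_tprod_one_sub_pow.continuousOn.continuousAt
    (Metric.ball_mem_nhds 0 one_pos)).tendsto
  simpa [← eulerProd.eq_def] using h

/-- The asymptotics of the partition generating function in a sector. -/
theorem tendsto_inv_eulerProd_div {r : ℝ} (hr : 0 < r) :
    Tendsto (fun z : ℂ => (eulerProd (Complex.exp (-(r * z))))⁻¹ /
      ((((r / (2 * Real.pi)) ^ (1 / 2 : ℝ) : ℝ) : ℂ) * z ^ (1 / 2 : ℂ) *
        Complex.exp (Real.pi ^ 2 / (6 * r * z)))) (𝓝[sector] 0) (𝓝 1) := by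
  have h1 : Tendsto (fun z : ℂ => Complex.exp (-(r * z) / 24)) (𝓝[sector] 0) (𝓝 1) := by
    have : Continuous fun z : ℂ => Complex.exp (-(r * z) / 24) := by fun_prop
    simpa using (this.tendsto 0).mono_left nhdsWithin_le_nhds
  have h2 := (tendsto_eulerProd_zero.comp (tendsto_exp_neg_div_sector
    (b := 4 * Real.pi ^ 2 / r) (by positivity))).inv₀ one_ne_zero
  have h3 := h1.mul h2
  rw [inv_one, mul_one] at h3
  refine h3.congr' (eventually_nhdsWithin_of_forall fun z hz => ?_)
  have hz0 : z ≠ 0 := by rintro rfl; simp [sector] at hz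
  simp only [Function.comp_apply]
  rw [inv_eulerProd_exp_neg hz.1 hr, mul_div_cancel_left₀]
  · simp [div_div]
  · refine mul_ne_zero (mul_ne_zero ?_ (by simp [hz0])) (Complex.exp_ne_zero _)
    exact_mod_cast (Real.rpow_pos_of_pos (by positivity) _).ne'

/-! ### Bounds away from the positive real axis -/

/-- In the series for -log (1 - |w|) + re log (1 - w), every term (|w|^n - re w^n)/n is nonnegative;
only the term n = 1 is kept. -/
theorem norm_inv_one_sub_le {w : ℂ} (hw : ‖w‖ < 1) :
    ‖(1 - w)⁻¹‖ ≤ ‖(1 - (‖w‖ : ℂ))⁻¹‖ * Real.exp (w.re - ‖w‖) := by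
  have hx : ‖((‖w‖ : ℝ) : ℂ)‖ < 1 := by simpa using hw
  have key : ∀ v : ℂ, ‖v‖ < 1 → ‖(1 - v)⁻¹‖ = Real.exp (-Complex.log (1 - v)).re := fun v hv => by
    have h0 : 1 - v ≠ 0 := by simpa using one_sub_pow_ne_zero hv 0
    rw [← Complex.norm_exp, Complex.exp_neg, Complex.exp_log h0]
  rw [key w hw, key _ hx, ← Real.exp_add, Real.exp_le_exp]
  have h1 := Complex.hasSum_re (Complex.hasSum_taylorSeries_neg_log hw)
  have h2 := Complex.hasSum_re (Complex.hasSum_taylorSeries_neg_log hx)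
  have h3 := h2.sub h1
  have h4 := sum_le_hasSum {1} (fun n _ => ?_) h3
  · simp at h4
    simp
    linarith
  · rw [sub_nonneg, Complex.div_natCast_re, Complex.div_natCast_re]
    refine div_le_div_of_nonneg_right ?_ (Nat.cast_nonneg n)
    rw [← Complex.ofReal_pow, Complex.ofReal_re, ← norm_pow]
    exact Complex.re_le_norm _

/-- Applying the one-factor bound at w = q^(j+1) and multiplying, the exponents add up to two
geometric series. -/
theorem norm_inv_eulerProd_le {q : ℂ} (hq : ‖q‖ < 1) :
    ‖(eulerProd q)⁻¹‖ ≤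
      ‖(eulerProd (‖q‖ : ℂ))⁻¹‖ * Real.exp ((q / (1 - q)).re - ‖q‖ / (1 - ‖q‖)) := by
  have hx : ‖((‖q‖ : ℝ) : ℂ)‖ < 1 := by simpa using hq
  have hlim : ∀ v : ℂ, ‖v‖ < 1 → Tendsto (fun J => ∏ j ∈ range J, ‖(1 - v ^ (j + 1))⁻¹‖) atTop
      (𝓝 ‖(eulerProd v)⁻¹‖) := fun v hv => by
    have h := (ModularForm.multipliable_one_sub_pow hv).hasProd.tendsto_prod_nat
    refine (h.inv₀ (eulerProd_ne_zero hv)).norm.congr fun J => ?_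
    rw [← Finset.prod_inv_distrib, norm_prod]
  have h1 : HasSum (fun n => (q ^ (n + 1)).re) (q / (1 - q)).re := by
    refine Complex.hasSum_re ?_
    simpa only [pow_succ', div_eq_mul_inv] using (hasSum_geometric_of_norm_lt_one hq).mul_left q
  have h2 : HasSum (fun n => ‖q‖ ^ (n + 1)) (‖q‖ / (1 - ‖q‖)) := by
    simpa only [pow_succ', div_eq_mul_inv] using
      (hasSum_geometric_of_lt_one (norm_nonneg q) hq).mul_left ‖q‖
  refine le_of_tendsto_of_tendsto (hlim q hq) ((hlim _ hx).mul
    ((Real.continuous_exp.tendsto _).comp (h1.sub h2).tendsto_sum_nat))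
    (Eventually.of_forall fun J => ?_)
  simp only [Function.comp_apply]
  rw [Real.exp_sum, ← Finset.prod_mul_distrib]
  refine Finset.prod_le_prod (fun _ _ => norm_nonneg _) fun j _ => ?_
  have := norm_inv_one_sub_le (w := q ^ (j + 1))
    (by rw [norm_pow]; exact pow_lt_one₀ (norm_nonneg q) hq j.succ_ne_zero)
  simpa only [norm_pow, Complex.ofReal_pow] using this

theorem norm_inv_eulerProd_le_norm {q : ℂ} (hq : ‖q‖ < 1) :
    ‖(eulerProd q)⁻¹‖ ≤ ‖(eulerProd (‖q‖ : ℂ))⁻¹‖ := by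
  refine (norm_inv_eulerProd_le hq).trans (mul_le_of_le_one_right (norm_nonneg _) ?_)
  rw [Real.exp_le_one_iff, sub_nonpos]
  have h1 : 1 - ‖q‖ ≤ ‖1 - q‖ := by simpa using norm_sub_norm_le 1 q
  refine (Complex.re_le_norm _).trans ?_
  rw [norm_div]
  have : 0 < 1 - ‖q‖ := by linarith
  gcongr

theorem normSq_one_sub_exp (t θ : ℝ) :
    ‖1 - Complex.exp (-(t + θ * Complex.I))‖ ^ 2 =
      (1 - Real.exp (-t)) ^ 2 + 4 * Real.exp (-t) * Real.sin (θ / 2) ^ 2 := by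
  have hs : 2 * Real.sin (θ / 2) ^ 2 = 1 - Real.cos θ := by
    rw [Real.sin_sq_eq_half_sub, mul_div_cancel₀ θ two_ne_zero]
    ring
  rw [Complex.sq_norm, Complex.normSq_apply, Complex.sub_re, Complex.sub_im, Complex.exp_re,
    Complex.exp_im]
  simp
  linear_combination (-2) * Real.exp (-t) * hs + Real.exp (-t) ^ 2 * Real.sin_sq_add_cos_sq θ

theorem norm_exp_neg (t θ : ℝ) : ‖Complex.exp (-(t + θ * Complex.I))‖ = Real.exp (-t) := by
  simp [Complex.norm_exp]

/-- Put ρ = e^(-t). From 1 - ρ ≤ t, ρ ≥ 1/2 and the sine bound, |1 - q|² ≥ (1 + 2κ²)(1 - ρ)² = η²(1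
- ρ)². So re (q/(1 - q)) falls short of ρ/(1 - ρ) by at least the fraction 1 - 1/η, and ρ/(1 - ρ) ≥
1/(2t). -/
theorem norm_inv_eulerProd_le_of_sin {κ : ℝ} (hκ : 0 < κ) :
    ∃ c > 0, ∀ t θ : ℝ, 0 < t → t ≤ 1 / 2 → κ * t ≤ |Real.sin (θ / 2)| →
      ‖(eulerProd (Complex.exp (-(t + θ * Complex.I))))⁻¹‖ ≤
        ‖(eulerProd (Real.exp (-t) : ℝ))⁻¹‖ * Real.exp (-(c / t)) := by
  set η := Real.sqrt (1 + 2 * κ ^ 2) with hη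
  have hη1 : 1 < η := Real.lt_sqrt_of_sq_lt (by nlinarith)
  have hη0 : 0 < η := by linarith
  refine ⟨(1 - 1 / η) / 2, ?_, fun t θ ht ht2 hs => ?_⟩
  · have : 1 / η < 1 := by rw [div_lt_one hη0]; exact hη1
    linarith
  have hρ1 : Real.exp (-t) < 1 := by simpa using ht
  have hρt : 1 - Real.exp (-t) ≤ t := by linarith [Real.add_one_le_exp (-t)]
  have hρ2 : 1 / 2 ≤ Real.exp (-t) := by linarith
  set q := Complex.exp (-(t + θ * Complex.I)) with hq
  have hqn : ‖q‖ = Real.exp (-t) := norm_exp_neg t θ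
  have h := norm_inv_eulerProd_le (q := q) (by rw [hqn]; exact hρ1)
  rw [hqn] at h
  refine h.trans (mul_le_mul_of_nonneg_left (Real.exp_le_exp.mpr ?_) (norm_nonneg _))
  set ρ := Real.exp (-t)
  have hd : 0 < 1 - ρ := by linarith
  have hsq : (κ * t) ^ 2 ≤ Real.sin (θ / 2) ^ 2 := by
    rw [← sq_abs (Real.sin _)]
    exact pow_le_pow_left₀ (by positivity) hs 2
  have h1 : (1 - ρ) * η ≤ ‖1 - q‖ := by
    refine le_of_sq_le_sq ?_ (norm_nonneg _)
    rw [normSq_one_sub_exp, mul_pow, hη, Real.sq_sqrt (by positivity)]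
    have h2 : (1 - ρ) ^ 2 ≤ t ^ 2 := pow_le_pow_left₀ hd.le hρt 2
    have h3 : κ ^ 2 * (1 - ρ) ^ 2 ≤ Real.sin (θ / 2) ^ 2 := by nlinarith [sq_nonneg κ]
    nlinarith [sq_nonneg (Real.sin (θ / 2))]
  have h2 : (q / (1 - q)).re ≤ ρ / (1 - ρ) * (1 / η) := by
    refine (Complex.re_le_norm _).trans ?_
    rw [norm_div, hqn, div_mul_div_comm, mul_one]
    gcongr
  have h3 : 1 / 2 / t ≤ ρ / (1 - ρ) := by gcongr
  have h4 : 0 ≤ 1 - 1 / η := by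
    rw [sub_nonneg, div_le_one hη0]; exact hη1.le
  calc (q / (1 - q)).re - ρ / (1 - ρ) ≤ -(ρ / (1 - ρ) * (1 - 1 / η)) := by linarith
    _ ≤ -(1 / 2 / t * (1 - 1 / η)) := neg_le_neg (mul_le_mul_of_nonneg_right h3 h4)
    _ = _ := by ring

theorem abs_sin_sum_le {ι : Type*} (s : Finset ι) (x : ι → ℝ) :
    |Real.sin (∑ i ∈ s, x i)| ≤ ∑ i ∈ s, |Real.sin (x i)| := by
  classical
  induction s using Finset.induction_on with
  | empty => simp
  | insert i s hi ih =>
    rw [sum_insert hi, sum_insert hi, Real.sin_add]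
    refine (abs_add_le _ _).trans (add_le_add ?_ (le_trans ?_ ih))
    · rw [abs_mul]
      exact mul_le_of_le_one_right (abs_nonneg _) (Real.abs_cos_le_one _)
    · rw [abs_mul]
      exact mul_le_of_le_one_left (abs_nonneg _) (Real.abs_cos_le_one _)

theorem abs_sin_int_mul_le (u : ℤ) (x : ℝ) : |Real.sin (u * x)| ≤ |(u : ℝ)| * |Real.sin x| := by
  have hn : ∀ n : ℕ, |Real.sin (n * x)| ≤ n * |Real.sin x| := fun n => by
    simpa using abs_sin_sum_le (range n) fun _ => x
  rcases Int.eq_nat_or_neg u with ⟨n, rfl | rfl⟩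
  · simpa using hn n
  · simpa using hn n

/-- Write 1 = ∑ u_m m by Bézout. Then |sin x| ≤ ∑ |u_m| |sin (m x)|, so the sines on the right
cannot all be much smaller than |sin x|. The 1 added to ∑ |u_m| makes the contradiction strict. -/
theorem exists_mul_le_abs_sin {S : Finset ℕ} (hgcd : S.gcd id = 1) :
    ∃ κ > 0, ∀ x : ℝ, ∃ m ∈ S, κ * |Real.sin x| ≤ |Real.sin (m * x)| := by
  obtain ⟨u, hu⟩ : ∃ u : ℕ → ℤ, ∑ m ∈ S, u m * m = 1 := by
    obtain ⟨g, hg⟩ := S.gcd_eq_sum_mul fun m => (m : ℤ)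
    set D := S.gcd fun m => (m : ℤ)
    have hD : D.natAbs = 1 := by
      rw [← Nat.dvd_one, ← hgcd]
      exact Finset.dvd_gcd fun m hm => Int.natAbs_dvd_natAbs.mpr (Finset.gcd_dvd hm)
    -- Only |D| = 1 is established, so the coefficients are multiplied by D to turn the sum into D²
    -- = 1.
    refine ⟨fun m => g m * D, ?_⟩
    calc ∑ m ∈ S, g m * D * m = D * D := by
          conv_rhs => rw [hg, sum_mul]
          rw [← hg]
          exact sum_congr rfl fun m _ => by ring
      _ = 1 := by rw [← Int.natAbs_mul_self' D, hD]; rfl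
  have hS : S.Nonempty := by
    rw [nonempty_iff_ne_empty]
    rintro rfl
    simp at hgcd
  set U := ∑ m ∈ S, |(u m : ℝ)| with hU
  have hU0 : 0 ≤ U := sum_nonneg fun _ _ => abs_nonneg _
  refine ⟨1 / (U + 1), by positivity, fun x => ?_⟩
  by_contra! hlt
  have h1 : x = ∑ m ∈ S, (u m : ℝ) * (m * x) := by
    have : ((∑ m ∈ S, u m * m : ℤ) : ℝ) = 1 := by rw [hu]; simp
    push_cast at this
    simp_rw [← mul_assoc, ← sum_mul, this, one_mul]
  have h2 : |Real.sin x| ≤ ∑ m ∈ S, |(u m : ℝ)| * (1 / (U + 1) * |Real.sin x|) := by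
    conv_lhs => rw [h1]
    refine (abs_sin_sum_le _ _).trans (sum_le_sum fun m hm => ?_)
    exact (abs_sin_int_mul_le _ _).trans
      (mul_le_mul_of_nonneg_left (hlt m hm).le (abs_nonneg _))
  obtain ⟨m, hm⟩ := hS
  have h3 : 0 < |Real.sin x| := by
    have := (abs_nonneg _).trans_lt (hlt m hm)
    exact (mul_pos_iff_of_pos_left (by positivity)).mp this
  rw [← sum_mul, ← mul_assoc, ← hU] at h2
  have h4 : U * (1 / (U + 1)) < 1 := by
    rw [mul_one_div, div_lt_one (by positivity)]
    linarith
  nlinarith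

/-- The function `∏ (∏ (1 - q ^ (m n)))⁻¹ ^ a m` of `q = e ^ (-z)`, the outer product being over
`m ∈ S` and the inner one over `n ≥ 1`. -/
noncomputable def expGenFun (S : Finset ℕ) (a : ℕ → ℕ) (z : ℂ) : ℂ :=
  ∏ m ∈ S, (eulerProd (Complex.exp (-z) ^ m))⁻¹ ^ a m

theorem exp_neg_pow_ofReal_add (t θ : ℝ) (m : ℕ) :
    Complex.exp (-(t + θ * Complex.I)) ^ m =
      Complex.exp (-((m * t : ℝ) + (m * θ : ℝ) * Complex.I)) := by
  rw [← Complex.exp_nat_mul]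
  push_cast
  ring_nf

theorem norm_inv_eulerProd_exp_pow_le {t : ℝ} (ht : 0 < t) (θ : ℝ) {m : ℕ} (hm : 0 < m) :
    ‖(eulerProd (Complex.exp (-(t + θ * Complex.I)) ^ m))⁻¹‖ ≤
      ‖(eulerProd (Complex.exp (-(t : ℂ)) ^ m))⁻¹‖ := by
  have hm' : (0 : ℝ) < m := by exact_mod_cast hm
  have h0 : 0 < m * t := by positivity
  have h := norm_inv_eulerProd_le_norm (q := Complex.exp (-(t + θ * Complex.I)) ^ m)
    (by rw [exp_neg_pow_ofReal_add, norm_exp_neg]; simpa using h0)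
  rw [exp_neg_pow_ofReal_add, norm_exp_neg] at h
  rw [exp_neg_pow_ofReal_add]
  convert! h using 4
  rw [← Complex.exp_nat_mul]
  push_cast
  ring_nf

/-- Away from the positive real axis the generating function is exponentially smaller. -/
theorem norm_expGenFun_le {S : Finset ℕ} {a : ℕ → ℕ} (hS : ∀ m ∈ S, 0 < m)
    (ha : ∀ m ∈ S, a m ≠ 0) (hgcd : S.gcd id = 1) :
    ∃ c > 0, ∀ᶠ t : ℝ in 𝓝[>] 0, ∀ θ : ℝ, t ≤ |θ| → |θ| ≤ Real.pi →
      ‖expGenFun S a (t + θ * Complex.I)‖ ≤ ‖expGenFun S a t‖ * Real.exp (-(c / t)) := by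
  obtain ⟨κ, hκ, hsin⟩ := exists_mul_le_abs_sin hgcd
  set M := S.sup id + 1 with hM
  have hM0 : (0 : ℝ) < M := by positivity
  have hmM : ∀ m ∈ S, (m : ℝ) ≤ M := fun m hm => by
    have : m ≤ S.sup id := Finset.le_sup (f := id) hm
    exact_mod_cast this.trans (Nat.le_succ _)
  -- The bound will be used at (mt, mθ): |sin (mθ/2)| ≥ κ t/π ≥ (κ/π/M)(mt), as m ≤ M.
  obtain ⟨c, hc, hgain⟩ := norm_inv_eulerProd_le_of_sin (κ := κ / Real.pi / M) (by positivity)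
  refine ⟨c / M, by positivity, ?_⟩
  filter_upwards [self_mem_nhdsWithin, nhdsWithin_le_nhds (eventually_le_nhds
    (show (0 : ℝ) < 1 / 2 / M by positivity))] with t (ht : 0 < t) htM θ hθ1 hθ2
  obtain ⟨m, hm, hms⟩ := hsin (θ / 2)
  have hm0 : (0 : ℝ) < m := by exact_mod_cast hS m hm
  have hjordan : t / Real.pi ≤ |Real.sin (θ / 2)| := by
    have h1 : 2 / Real.pi * |θ / 2| ≤ |Real.sin (θ / 2)| := by
      refine Real.mul_abs_le_abs_sin ?_
      rw [abs_div, abs_two]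
      linarith
    refine le_trans ?_ h1
    rw [abs_div, abs_two, div_mul_div_comm, mul_comm Real.pi, mul_div_mul_left _ _ two_ne_zero]
    gcongr
  have hgain' := hgain (m * t) (m * θ) (by positivity) ?_ ?_
  -- Only the factor selected by Bézout supplies the gain; the others are bounded by their values on
  -- the real axis.
  · set g : ℕ → ℝ := fun j => if j = m then Real.exp (-(c / M / t)) else 1 with hg
    have hprod : ∏ j ∈ S, g j = Real.exp (-(c / M / t)) := by
      rw [hg, Finset.prod_ite_eq' S m, if_pos hm]
    rw [expGenFun, expGenFun, norm_prod, norm_prod, ← hprod, ← Finset.prod_mul_distrib]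
    refine Finset.prod_le_prod (fun _ _ => norm_nonneg _) fun j hj => ?_
    rw [norm_pow, norm_pow]
    by_cases hjm : j = m
    · subst hjm
      have h1 : ‖(eulerProd (Complex.exp (-(t + θ * Complex.I)) ^ j))⁻¹‖ ≤
          ‖(eulerProd (Complex.exp (-(t : ℂ)) ^ j))⁻¹‖ * Real.exp (-(c / M / t)) := by
        rw [exp_neg_pow_ofReal_add]
        refine hgain'.trans ?_
        have h2 : Complex.exp (-(t : ℂ)) ^ j = ((Real.exp (-(j * t)) : ℝ) : ℂ) := by
          rw [← Complex.exp_nat_mul]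
          push_cast
          ring_nf
        rw [h2]
        refine mul_le_mul_of_nonneg_left (Real.exp_le_exp.mpr (neg_le_neg ?_)) (norm_nonneg _)
        rw [div_div]
        have := hmM j hj
        gcongr
      simp only [hg, if_true]
      refine (pow_le_pow_left₀ (norm_nonneg _) h1 _).trans ?_
      rw [mul_pow]
      refine mul_le_mul_of_nonneg_left ?_ (by positivity)
      refine pow_le_of_le_one (Real.exp_nonneg _) ?_ (ha j hj)
      rw [Real.exp_le_one_iff, neg_nonpos]
      positivity
    · simp only [hg, if_neg hjm, mul_one]
      exact pow_le_pow_left₀ (norm_nonneg _) (norm_inv_eulerProd_exp_pow_le ht θ (hS j hj)) _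
  · calc m * t ≤ M * (1 / 2 / M) := by
          have := hmM m hm
          gcongr
      _ = 1 / 2 := by field_simp
  · rw [mul_div_assoc]
    refine le_trans ?_ hms
    calc κ / Real.pi / M * (m * t) = κ * (t / Real.pi) * (m / M) := by ring
      _ ≤ κ * (t / Real.pi) := mul_le_of_le_one_right (by positivity)
          ((div_le_one hM0).mpr (hmM m hm))
      _ ≤ _ := by gcongr

/-! ### Asymptotics and continuity of the finite product -/

theorem tendsto_expGenFun_div (S : Finset ℕ) (a : ℕ → ℕ) (hS : ∀ m ∈ S, 0 < m) :
    Tendsto (fun z : ℂ => expGenFun S a z /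
      (((∏ m ∈ S, ((m : ℝ) / (2 * Real.pi)) ^ ((a m : ℝ) / 2) : ℝ) : ℂ) *
        z ^ (((∑ m ∈ S, (a m : ℝ)) / 2 : ℝ) : ℂ) *
        Complex.exp ((Real.pi ^ 2 * (∑ m ∈ S, (a m : ℝ) / m) / 6 : ℝ) / z)))
      (𝓝[sector] 0) (𝓝 1) := by
  have h := tendsto_finsetProd S fun m hm =>
    (tendsto_inv_eulerProd_div (r := m) (by exact_mod_cast hS m hm)).pow (a m)
  simp only [one_pow, Finset.prod_const_one] at h
  refine h.congr' (eventually_nhdsWithin_of_forall fun z hz => ?_)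
  have hz0 : z ≠ 0 := by rintro rfl; simp [sector] at hz
  simp only [div_pow, Finset.prod_div_distrib, mul_pow, Finset.prod_mul_distrib]
  congr 1
  · refine Finset.prod_congr rfl fun m _ => ?_
    rw [← Complex.exp_nat_mul, Complex.ofReal_natCast, mul_neg]
  · congr 1
    · congr 1
      · rw [Complex.ofReal_prod]
        refine Finset.prod_congr rfl fun m _ => ?_
        rw [← Complex.ofReal_pow, ← Real.rpow_natCast, ← Real.rpow_mul (by positivity)]
        congr 2
        ring
      · rw [Complex.cpow_def_of_ne_zero hz0, Complex.cpow_def_of_ne_zero hz0]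
        simp only [← Complex.exp_nat_mul, ← Complex.exp_sum]
        congr 1
        push_cast
        rw [Finset.sum_div, Finset.mul_sum]
        exact Finset.sum_congr rfl fun m _ => by ring
    · simp only [← Complex.exp_nat_mul, ← Complex.exp_sum]
      congr 1
      push_cast
      rw [Finset.mul_sum, Finset.sum_div, Finset.sum_div]
      refine Finset.sum_congr rfl fun m hm => ?_
      have : (m : ℂ) ≠ 0 := by exact_mod_cast (hS m hm).ne'
      field_simp

theorem continuousOn_eulerProd : ContinuousOn eulerProd (Metric.ball 0 1) :=
  ModularForm.differentiableOn_tprod_one_sub_pow.continuousOn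

theorem norm_exp_neg_pow_lt_one {z : ℂ} (hz : 0 < z.re) {m : ℕ} (hm : 0 < m) :
    ‖Complex.exp (-z) ^ m‖ < 1 := by
  rw [norm_pow, Complex.norm_exp, Complex.neg_re]
  exact pow_lt_one₀ (Real.exp_nonneg _) (by simpa using hz) hm.ne'

theorem continuousOn_expGenFun (S : Finset ℕ) (a : ℕ → ℕ) (hS : ∀ m ∈ S, 0 < m) :
    ContinuousOn (expGenFun S a) {z | 0 < z.re} := by
  refine continuousOn_finsetProd S fun m hm => ContinuousOn.pow (ContinuousOn.inv₀ ?_ ?_) _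
  · refine continuousOn_eulerProd.comp (by fun_prop) fun z hz => ?_
    rw [mem_ball_zero_iff]
    exact norm_exp_neg_pow_lt_one hz (hS m hm)
  · exact fun z hz => eulerProd_ne_zero (norm_exp_neg_pow_lt_one hz (hS m hm))

/-! ### Saddle point method -/

theorem ofReal_mul_cpow {r : ℝ} (hr : 0 < r) {w : ℂ} (hw : w ≠ 0) (β : ℝ) :
    ((r : ℂ) * w) ^ (β : ℂ) = ((r ^ β : ℝ) : ℂ) * w ^ (β : ℂ) := by
  have hr0 : (r : ℂ) ≠ 0 := by exact_mod_cast hr.ne'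
  rw [Complex.ofReal_cpow hr.le, Complex.cpow_def_of_ne_zero (mul_ne_zero hr0 hw),
    Complex.cpow_def_of_ne_zero hr0, Complex.cpow_def_of_ne_zero hw, Complex.log_ofReal_mul hr hw,
    ← Complex.ofReal_log hr.le, ← Complex.exp_add, add_mul]

section SaddlePoint

variable {f : ℂ → ℂ} {A β l : ℝ}

/-- Rescaling `z = t w` near the saddle point `z = t` of `exp (A / z + A z / t ^ 2)`. -/
theorem saddle_rescale {t u : ℝ} (hA : 0 < A) (hl : 0 < l) (ht : 0 < t) {w : ℂ}
    (hw : w = 1 + (Real.sqrt (t / A) * u : ℝ) * Complex.I) :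
    f (t * w) * Complex.exp (A / t ^ 2 * (t * w)) =
      (l * t ^ β * Real.exp (2 * A / t) : ℝ) *
        (f (t * w) / (l * (t * w) ^ (β : ℂ) * Complex.exp (A / (t * w))) * w ^ (β : ℂ) *
          Complex.exp (-(u ^ 2 / w))) := by
  have hw0 : w ≠ 0 := by
    intro h
    have := congrArg Complex.re (hw.symm.trans h)
    simp at this
  have ht0 : (t : ℂ) ≠ 0 := by exact_mod_cast ht.ne'
  have hA0 : (A : ℂ) ≠ 0 := by exact_mod_cast hA.ne'
  have hl0 : (l : ℂ) ≠ 0 := by exact_mod_cast hl.ne'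
  have hwβ : w ^ (β : ℂ) ≠ 0 := by simp [hw0]
  have htβ : ((t ^ β : ℝ) : ℂ) ≠ 0 := by exact_mod_cast (Real.rpow_pos_of_pos ht β).ne'
  -- This gives A/(tw) + Aw/t = 2A/t + A(w - 1)²/(tw) = 2A/t - u²/w.
  have hsq : (A : ℂ) * (w - 1) ^ 2 = -(t * u ^ 2) := by
    have h1 : A * (Real.sqrt (t / A) * u) ^ 2 = t * u ^ 2 := by
      rw [mul_pow, Real.sq_sqrt (by positivity)]
      field_simp
    have h2 : (A : ℂ) * ((Real.sqrt (t / A) * u : ℝ) : ℂ) ^ 2 = t * u ^ 2 := by exact_mod_cast h1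
    rw [hw]
    linear_combination (-1) * h2 + (A : ℂ) * ((Real.sqrt (t / A) * u : ℝ) : ℂ) ^ 2 * Complex.I_sq
  have hexp : Complex.exp (A / t ^ 2 * (t * w)) * Complex.exp (A / (t * w)) =
      Complex.exp (2 * A / t) * Complex.exp (-(u ^ 2 / w)) := by
    rw [← Complex.exp_add, ← Complex.exp_add]
    congr 1
    field_simp
    linear_combination hsq
  have he := Complex.exp_ne_zero (A / (t * w))
  rw [ofReal_mul_cpow ht hw0]
  push_cast at htβ ⊢
  rw [eq_div_of_mul_eq he hexp]
  generalize Complex.exp (A / (t * w)) = E at he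
  generalize Complex.exp (2 * A / t) = E'
  field_simp

/-- Put θ = t √(t/A) u. The arc |θ| ≤ t is exactly the part of the line re z = t in the sector, so
the hypothesis on f applies throughout. The rescaled integrand tends to e^(-u²), and dominated
convergence gives the Gaussian integral √π. -/
theorem tendsto_saddle_central (hA : 0 < A) (hβ : 0 ≤ β) (hl : 0 < l)
    (hf : Tendsto (fun z => f z / (l * z ^ (β : ℂ) * Complex.exp (A / z))) (𝓝[sector] 0) (𝓝 1))
    (hc : ContinuousOn f {z | 0 < z.re}) :
    Tendsto (fun t : ℝ => (∫ θ in -t..t, f (t + θ * Complex.I) *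
        Complex.exp (A / t ^ 2 * (t + θ * Complex.I))) /
      (l * t ^ β * Real.exp (2 * A / t) * (t * Real.sqrt (t / A)) : ℝ))
      (𝓝[>] 0) (𝓝 (Real.sqrt Real.pi : ℝ)) := by
  set W : ℝ → ℝ → ℂ := fun t u => 1 + (Real.sqrt (t / A) * u : ℝ) * Complex.I with hW
  have hWre : ∀ t u, (W t u).re = 1 := fun t u => by simp [hW]
  have hWim : ∀ t u, (W t u).im = Real.sqrt (t / A) * u := fun t u => by simp [hW]
  have hW0 : ∀ t u, W t u ≠ 0 := fun t u h => by simpa [h] using hWre t u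
  have hWc : ∀ t, Continuous (W t) := fun t => by fun_prop
  set K : ℝ → ℝ → ℂ := fun t u =>
    f (t * W t u) / (l * (t * W t u) ^ (β : ℂ) * Complex.exp (A / (t * W t u))) *
      W t u ^ (β : ℂ) * Complex.exp (-(u ^ 2 / W t u)) with hK
  set F : ℝ → ℝ → ℂ := fun t =>
    Set.indicator {u | |Real.sqrt (t / A) * u| ≤ 1} (K t) with hF
  have hsec : ∀ {t u : ℝ}, 0 < t → |Real.sqrt (t / A) * u| ≤ 1 → (t * W t u : ℂ) ∈ sector := by
    intro t u ht hu
    rw [sector, Set.mem_ofPred_eq, Complex.re_ofReal_mul, Complex.im_ofReal_mul, hWre, hWim, mul_one,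
      abs_mul, abs_of_pos ht]
    exact ⟨ht, mul_le_of_le_one_right ht.le hu⟩
  have hmain : ∀ t : ℝ, 0 < t → (∫ θ in -t..t, f (t + θ * Complex.I) *
        Complex.exp (A / t ^ 2 * (t + θ * Complex.I))) /
      (l * t ^ β * Real.exp (2 * A / t) * (t * Real.sqrt (t / A)) : ℝ) = ∫ u, F t u := by
    intro t ht
    have hσ : 0 < Real.sqrt (t / A) := Real.sqrt_pos.mpr (by positivity)
    have hD : 0 < l * t ^ β * Real.exp (2 * A / t) := by positivity
    have hset : {u | |Real.sqrt (t / A) * u| ≤ 1} =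
        Set.Icc (-(1 / Real.sqrt (t / A))) (1 / Real.sqrt (t / A)) := by
      ext u
      rw [Set.mem_ofPred_eq, Set.mem_Icc, ← abs_le, abs_mul, abs_of_pos hσ, le_div_iff₀ hσ, mul_comm]
    have hsub := intervalIntegral.smul_integral_comp_mul_left
      (fun θ : ℝ => f (t + θ * Complex.I) * Complex.exp (A / t ^ 2 * (t + θ * Complex.I)))
      (t * Real.sqrt (t / A)) (a := -(1 / Real.sqrt (t / A))) (b := 1 / Real.sqrt (t / A))
    rw [mul_neg, mul_assoc t, mul_one_div_cancel hσ.ne', mul_one] at hsub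
    have hpt : ∀ u : ℝ, f (t + (t * Real.sqrt (t / A) * u : ℝ) * Complex.I) *
        Complex.exp (A / t ^ 2 * (t + (t * Real.sqrt (t / A) * u : ℝ) * Complex.I)) =
        (l * t ^ β * Real.exp (2 * A / t) : ℝ) * K t u := by
      intro u
      have h1 : (t + (t * Real.sqrt (t / A) * u : ℝ) * Complex.I : ℂ) = t * W t u := by
        simp only [hW]
        push_cast
        ring
      rw [h1]
      exact saddle_rescale hA hl ht rfl
    simp_rw [hpt] at hsub
    rw [← hsub, intervalIntegral.integral_const_mul, hF]
    simp only
    rw [hset, MeasureTheory.integral_indicator measurableSet_Icc,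
      MeasureTheory.integral_Icc_eq_integral_Ioc,
      ← intervalIntegral.integral_of_le (by have := one_div_pos.mpr hσ; linarith),
      Complex.real_smul, div_eq_iff (by exact_mod_cast (mul_pos hD (mul_pos ht hσ)).ne')]
    push_cast
    ring
  have hgauss : ((Real.sqrt Real.pi : ℝ) : ℂ) = ∫ u : ℝ, ((Real.exp (-1 * u ^ 2) : ℝ) : ℂ) := by
    rw [integral_complex_ofReal, integral_gaussian, div_one]
  rw [hgauss]
  refine Tendsto.congr' (eventually_nhdsWithin_of_forall fun t ht => (hmain t ht).symm) ?_
  have htend : ∀ u, Tendsto (fun t => Real.sqrt (t / A) * u) (𝓝[>] 0) (𝓝 0) := fun u => by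
    have : Continuous fun t => Real.sqrt (t / A) * u := by fun_prop
    simpa using (this.tendsto 0).mono_left nhdsWithin_le_nhds
  refine MeasureTheory.tendsto_integral_filter_of_dominated_convergence
    -- On the support the ratio of f to its model is at most 2 for small t, |W| ≤ 2, and re (u²/W) =
    -- u²/|W|² ≥ u²/2 because |im W| ≤ 1 = re W.
    (fun u => 2 * 2 ^ β * Real.exp (-(1 / 2) * u ^ 2)) ?_ ?_ ?_ ?_
  · refine eventually_nhdsWithin_of_forall fun t (ht : 0 < t) => ?_
    have hKc : Continuous (K t) := by
      have htW : Continuous fun u => (t : ℂ) * W t u := by fun_prop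
      have hslit : ∀ u, (t : ℂ) * W t u ∈ Complex.slitPlane := fun u => by
        left
        rw [Complex.re_ofReal_mul, hWre, mul_one]
        exact ht
      have ht0 : ∀ u, (t : ℂ) * W t u ≠ 0 := fun u => Complex.slitPlane_ne_zero (hslit u)
      have hl0 : (l : ℂ) ≠ 0 := by exact_mod_cast hl.ne'
      refine ((Continuous.div ?_ ?_ ?_).mul ?_).mul ?_
      · refine hc.comp_continuous htW fun u => ?_
        rw [Set.mem_ofPred_eq, Complex.re_ofReal_mul, hWre, mul_one]
        exact ht
      · exact (continuous_const.mul (htW.cpow continuous_const hslit)).mul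
          (Complex.continuous_exp.comp (continuous_const.div htW ht0))
      · exact fun u => mul_ne_zero (mul_ne_zero hl0 (by simp [ht0 u])) (Complex.exp_ne_zero _)
      · exact (hWc t).cpow continuous_const fun u => by left; rw [hWre]; exact one_pos
      · exact Complex.continuous_exp.comp
          ((Continuous.div (by fun_prop) (hWc t) (hW0 t)).neg)
    refine hKc.aestronglyMeasurable.indicator (measurableSet_le ?_ measurable_const)
    fun_prop
  · have h2 : ∀ᶠ z in 𝓝[sector] (0 : ℂ),
        ‖f z / (l * z ^ (β : ℂ) * Complex.exp (A / z))‖ ≤ 2 :=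
      hf.norm.eventually_le_const (by norm_num)
    obtain ⟨ε, hε, h3⟩ := Metric.mem_nhdsWithin_iff.mp h2
    filter_upwards [self_mem_nhdsWithin, nhdsWithin_le_nhds (eventually_lt_nhds (half_pos hε))]
      with t (ht : 0 < t) htε
    refine Eventually.of_forall fun u => ?_
    by_cases hu : u ∈ {u | |Real.sqrt (t / A) * u| ≤ 1}
    · have hv : |Real.sqrt (t / A) * u| ≤ 1 := hu
      have hWn : ‖W t u‖ ≤ 2 := by
        refine (norm_add_le _ _).trans ?_
        rw [norm_one, norm_mul, Complex.norm_I, mul_one, Complex.norm_real, Real.norm_eq_abs]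
        linarith
      have hR := h3 ⟨(?_ : (t * W t u : ℂ) ∈ Metric.ball 0 ε), hsec ht hv⟩
      · have hre : 1 / 2 * u ^ 2 ≤ ((u : ℂ) ^ 2 / W t u).re := by
          have hv2 := (sq_le_one_iff_abs_le_one _).mpr hv
          rw [div_eq_mul_inv ((u : ℂ) ^ 2), ← Complex.ofReal_pow, Complex.re_ofReal_mul, Complex.inv_re,
            Complex.normSq_apply, hWre, hWim, mul_comm]
          refine mul_le_mul_of_nonneg_left ?_ (sq_nonneg u)
          rw [div_le_div_iff₀ two_pos (by nlinarith)]
          linarith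
        rw [hF]
        simp only
        rw [Set.indicator_of_mem hu, norm_mul, norm_mul, Complex.norm_exp,
          Complex.norm_cpow_of_ne_zero (hW0 t u), Complex.ofReal_re, Complex.ofReal_im, mul_zero,
          Real.exp_zero, div_one, Complex.neg_re, neg_mul]
        have hR' : ‖f (t * W t u) / (l * (t * W t u) ^ (β : ℂ) *
          Complex.exp (A / (t * W t u)))‖ ≤ 2 := hR
        gcongr
      · rw [mem_ball_zero_iff, norm_mul, Complex.norm_real, Real.norm_of_nonneg ht.le]
        nlinarith
    · rw [hF]
      simp only
      rw [Set.indicator_of_notMem hu, norm_zero]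
      positivity
  · exact (integrable_exp_neg_mul_sq (by norm_num)).const_mul _
  · refine Eventually.of_forall fun u => ?_
    have hW1 : Tendsto (fun t => W t u) (𝓝[>] 0) (𝓝 1) := by
      have : Continuous fun t => W t u := by simp only [hW]; fun_prop
      simpa [hW] using (this.tendsto 0).mono_left nhdsWithin_le_nhds
    have hev : ∀ᶠ t in 𝓝[>] (0 : ℝ), |Real.sqrt (t / A) * u| ≤ 1 :=
      (htend u).abs.eventually_le_const (by simp)
    have hz : Tendsto (fun t : ℝ => (t * W t u : ℂ)) (𝓝[>] 0) (𝓝[sector] 0) := by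
      refine tendsto_nhdsWithin_iff.mpr ⟨?_, ?_⟩
      · have h1 : Tendsto (fun t : ℝ => (t : ℂ)) (𝓝[>] 0) (𝓝 0) := by
          simpa using (Complex.continuous_ofReal.tendsto 0).mono_left nhdsWithin_le_nhds
        simpa using h1.mul hW1
      · filter_upwards [hev, self_mem_nhdsWithin] with t h1 ht using hsec ht h1
    have hlim : Tendsto (fun t => K t u) (𝓝[>] 0) (𝓝 ((Real.exp (-1 * u ^ 2) : ℝ) : ℂ)) := by
      have h1 := hf.comp hz
      have h2 : Tendsto (fun t => W t u ^ (β : ℂ)) (𝓝[>] 0) (𝓝 1) := by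
        simpa using hW1.cpow (tendsto_const_nhds (x := (β : ℂ))) (by simp)
      have h3 := (Complex.continuous_exp.tendsto _).comp
        ((tendsto_const_nhds (x := (u : ℂ) ^ 2)).div hW1 one_ne_zero).neg
      simpa using (h1.mul h2).mul h3
    refine hlim.congr' ?_
    filter_upwards [hev] with t ht
    exact (Set.indicator_of_mem (s := {u | |Real.sqrt (t / A) * u| ≤ 1}) ht (K t)).symm

/-- For t ≤ |θ| ≤ π the integrand is at most 2 l t^β e^(2A/t) e^(-c/t). Divided by the main term
this is of order t^(-3/2) e^(-c/t), which tends to 0. -/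
theorem tendsto_saddle (hA : 0 < A) (hβ : 0 ≤ β) (hl : 0 < l)
    (hf : Tendsto (fun z => f z / (l * z ^ (β : ℂ) * Complex.exp (A / z))) (𝓝[sector] 0) (𝓝 1))
    (hc : ContinuousOn f {z | 0 < z.re})
    (hminor : ∃ c > 0, ∀ᶠ t : ℝ in 𝓝[>] 0, ∀ θ : ℝ, t ≤ |θ| → |θ| ≤ Real.pi →
      ‖f (t + θ * Complex.I)‖ ≤ ‖f t‖ * Real.exp (-(c / t))) :
    Tendsto (fun t : ℝ => (∫ θ in -Real.pi..Real.pi, f (t + θ * Complex.I) *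
        Complex.exp (A / t ^ 2 * (t + θ * Complex.I))) /
      (l * t ^ β * Real.exp (2 * A / t) * (t * Real.sqrt (t / A)) : ℝ))
      (𝓝[>] 0) (𝓝 (Real.sqrt Real.pi : ℝ)) := by
  obtain ⟨c, hc0, hminor⟩ := hminor
  set g : ℝ → ℝ → ℂ := fun t θ => f (t + θ * Complex.I) *
    Complex.exp (A / t ^ 2 * (t + θ * Complex.I)) with hg
  set D : ℝ → ℝ := fun t => l * t ^ β * Real.exp (2 * A / t) * (t * Real.sqrt (t / A)) with hD
  have hcentral : Tendsto (fun t : ℝ => (∫ θ in -t..t, g t θ) / (D t : ℂ)) (𝓝[>] 0)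
      (𝓝 (Real.sqrt Real.pi : ℝ)) := tendsto_saddle_central hA hβ hl hf hc
  have hreal : Tendsto (fun t : ℝ => (t : ℂ)) (𝓝[>] 0) (𝓝[sector] 0) := by
    refine tendsto_nhdsWithin_iff.mpr ⟨?_, ?_⟩
    · simpa using (Complex.continuous_ofReal.tendsto 0).mono_left nhdsWithin_le_nhds
    · exact eventually_nhdsWithin_of_forall fun t (ht : 0 < t) => ⟨by simpa using ht,
        by simpa using ht.le⟩
  have hft : ∀ᶠ t : ℝ in 𝓝[>] 0, ‖f t‖ ≤ 2 * (l * t ^ β * Real.exp (A / t)) := by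
    filter_upwards [self_mem_nhdsWithin,
      (hf.comp hreal).norm.eventually_le_const (by norm_num : ‖(1 : ℂ)‖ < 2)] with t (ht : 0 < t) h
    have hpos : 0 < l * t ^ β * Real.exp (A / t) := by positivity
    rw [Function.comp_apply, ← Complex.ofReal_cpow ht.le, ← Complex.ofReal_div,
      ← Complex.ofReal_exp, ← Complex.ofReal_mul, ← Complex.ofReal_mul, norm_div,
      Complex.norm_real, Real.norm_of_nonneg hpos.le, div_le_iff₀ hpos] at h
    exact h
  -- The constant 4π comes from two arcs of length at most π and the factor 2 in the bound on
  -- |f(t)|.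
  have hsmall : Tendsto (fun t : ℝ => 4 * Real.pi * (Real.exp (-(c / t)) /
      (t * Real.sqrt (t / A)))) (𝓝[>] 0) (𝓝 0) := by
    have h := ((tendsto_rpow_mul_exp_neg_mul_atTop_nhds_zero (3 / 2) c hc0).comp
      tendsto_inv_nhdsGT_zero).const_mul (4 * Real.pi * Real.sqrt A)
    rw [mul_zero] at h
    refine h.congr' (eventually_nhdsWithin_of_forall fun t (ht : 0 < t) => ?_)
    simp only [Function.comp_apply]
    rw [show (3 / 2 : ℝ) = 1 + 1 / 2 by norm_num,
      Real.rpow_add (inv_pos.mpr ht), Real.rpow_one, ← Real.sqrt_eq_rpow, Real.sqrt_inv,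
      Real.sqrt_div ht.le, neg_mul, ← div_eq_mul_inv]
    have h1 := Real.sqrt_pos.mpr ht
    have h2 := Real.sqrt_pos.mpr hA
    field_simp
  have hsplit : ∀ᶠ t : ℝ in 𝓝[>] 0, ‖(∫ θ in -Real.pi..Real.pi, g t θ) / (D t : ℂ) -
      (∫ θ in -t..t, g t θ) / (D t : ℂ)‖ ≤
        4 * Real.pi * (Real.exp (-(c / t)) / (t * Real.sqrt (t / A))) := by
    filter_upwards [self_mem_nhdsWithin, hft, hminor,
      nhdsWithin_le_nhds (eventually_le_nhds Real.pi_pos)] with t (ht : 0 < t) h1 h2 htπ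
    have hgc : Continuous (g t) := by
      refine Continuous.mul (hc.comp_continuous (by fun_prop) fun θ => ?_) (by fun_prop)
      simpa using ht
    have hint : ∀ a b : ℝ, IntervalIntegrable (g t) MeasureTheory.volume a b := fun a b =>
      hgc.intervalIntegrable a b
    have hDt : 0 < D t := by
      have := Real.sqrt_pos.mpr (div_pos ht hA)
      simp only [hD]
      positivity
    set C := 2 * (l * t ^ β * Real.exp (2 * A / t)) * Real.exp (-(c / t)) with hC
    have hC0 : 0 ≤ C := by positivity
    have hb : ∀ θ : ℝ, t ≤ |θ| → |θ| ≤ Real.pi → ‖g t θ‖ ≤ C := fun θ h3 h4 => by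
      have h5 : ‖Complex.exp (A / t ^ 2 * (t + θ * Complex.I))‖ = Real.exp (A / t) := by
        rw [Complex.norm_exp, ← Complex.ofReal_pow, ← Complex.ofReal_div, Complex.re_ofReal_mul]
        congr 1
        simp
        field_simp
      have h6 : Real.exp (2 * A / t) = Real.exp (A / t) * Real.exp (A / t) := by
        rw [← Real.exp_add]
        congr 1
        ring
      calc ‖g t θ‖ = ‖f (t + θ * Complex.I)‖ * Real.exp (A / t) := by rw [hg, norm_mul, h5]
        _ ≤ 2 * (l * t ^ β * Real.exp (A / t)) * Real.exp (-(c / t)) * Real.exp (A / t) := by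
          gcongr
          refine (h2 θ h3 h4).trans ?_
          gcongr
        _ = C := by rw [hC, h6]; ring
    have e1 : ‖∫ θ in -Real.pi..-t, g t θ‖ ≤ C * Real.pi := by
      refine (intervalIntegral.norm_integral_le_of_norm_le_const fun θ hθ => ?_).trans
        (mul_le_mul_of_nonneg_left (b := |-t - -Real.pi|) ?_ hC0)
      · rw [Set.uIoc_of_le (by linarith)] at hθ
        have : |θ| = -θ := abs_of_nonpos (by linarith [hθ.2])
        exact hb θ (by linarith [hθ.2]) (by linarith [hθ.1])
      · rw [abs_of_nonneg (by linarith)]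
        linarith
    have e2 : ‖∫ θ in t..Real.pi, g t θ‖ ≤ C * Real.pi := by
      refine (intervalIntegral.norm_integral_le_of_norm_le_const fun θ hθ => ?_).trans
        (mul_le_mul_of_nonneg_left (b := |Real.pi - t|) ?_ hC0)
      · rw [Set.uIoc_of_le htπ] at hθ
        have : |θ| = θ := abs_of_nonneg (by linarith [hθ.1])
        exact hb θ (by linarith [hθ.1]) (by linarith [hθ.2])
      · rw [abs_of_nonneg (by linarith)]
        linarith
    rw [← intervalIntegral.integral_add_adjacent_intervals (hint (-Real.pi) (-t)) (hint _ _),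
      ← intervalIntegral.integral_add_adjacent_intervals (hint (-t) t) (hint _ _), ← sub_div,
      norm_div, Complex.norm_real, Real.norm_of_nonneg hDt.le, div_le_iff₀ hDt]
    calc _ = ‖(∫ θ in -Real.pi..-t, g t θ) + ∫ θ in t..Real.pi, g t θ‖ := by congr 1; ring
      _ ≤ C * Real.pi + C * Real.pi := (norm_add_le _ _).trans (add_le_add e1 e2)
      _ = _ := by
        have := Real.sqrt_pos.mpr (div_pos ht hA)
        rw [hC, hD]
        field_simp
        ring
  have h0 := squeeze_zero_norm' hsplit hsmall
  simpa only [sub_add_cancel, zero_add] using h0.add hcentral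

end SaddlePoint

/-! ### Coefficient extraction and the coprime case -/

/-- Cauchy's formula on |q| = e^(-t): the series is integrated term by term and orthogonality leaves
only m = n. -/
theorem integral_eq_coeff {c : ℕ → ℂ} {G : ℂ → ℂ}
    (h : ∀ q : ℂ, ‖q‖ < 1 → HasSum (fun n => c n * q ^ n) (G q)) {t : ℝ} (ht : 0 < t) (n : ℕ) :
    ∫ θ in -Real.pi..Real.pi, G (Complex.exp (-(t + θ * Complex.I))) *
      Complex.exp (n * (t + θ * Complex.I)) = 2 * Real.pi * c n := by
  have hρ : ‖((Real.exp (-t) : ℝ) : ℂ)‖ < 1 := by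
    rw [Complex.norm_real, Real.norm_of_nonneg (Real.exp_nonneg _)]
    simpa using ht
  have hsum := (h _ hρ).summable.norm
  have key := intervalIntegral.hasSum_integral_of_dominated_convergence
    (μ := MeasureTheory.volume) (a := -Real.pi) (b := Real.pi)
    (F := fun m (θ : ℝ) => c m * Complex.exp (-(t + θ * Complex.I)) ^ m *
      Complex.exp (n * (t + θ * Complex.I)))
    (f := fun θ : ℝ => G (Complex.exp (-(t + θ * Complex.I))) *
      Complex.exp (n * (t + θ * Complex.I)))
    (fun m _ => ‖c m * ((Real.exp (-t) : ℝ) : ℂ) ^ m‖ * Real.exp (n * t))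
    (fun m => (by fun_prop : Continuous _).aestronglyMeasurable) ?_ ?_ ?_ ?_
  · have hterm : ∀ m : ℕ, ∫ θ in -Real.pi..Real.pi, c m *
        Complex.exp (-(t + θ * Complex.I)) ^ m * Complex.exp (n * (t + θ * Complex.I)) =
        if m = n then 2 * Real.pi * c n else 0 := by
      intro m
      have h1 : ∀ θ : ℝ, c m * Complex.exp (-(t + θ * Complex.I)) ^ m *
          Complex.exp (n * (t + θ * Complex.I)) =
          c m * Complex.exp (((n : ℂ) - m) * t) *
            Complex.exp ((((n : ℂ) - m) * Complex.I) * θ) := fun θ => by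
        rw [← Complex.exp_nat_mul, mul_assoc, mul_assoc, ← Complex.exp_add, ← Complex.exp_add]
        ring_nf
      simp_rw [h1, intervalIntegral.integral_const_mul]
      split_ifs with hmn
      · subst hmn
        simp
        ring
      · have hne : ((n : ℂ) - m) * Complex.I ≠ 0 :=
          mul_ne_zero (sub_ne_zero.mpr (by exact_mod_cast Ne.symm hmn)) Complex.I_ne_zero
        rw [integral_exp_mul_complex hne]
        have h2 : Complex.exp (((n : ℂ) - m) * Complex.I * Real.pi) =
            Complex.exp (((n : ℂ) - m) * Complex.I * (-Real.pi : ℝ)) := by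
          rw [Complex.exp_eq_exp_iff_exists_int]
          refine ⟨n - m, ?_⟩
          push_cast
          ring
        rw [h2, sub_self, zero_div, mul_zero]
    simp_rw [hterm] at key
    exact key.unique (hasSum_ite_eq n _)
  · refine fun m => Eventually.of_forall fun θ _ => le_of_eq ?_
    rw [norm_mul, norm_mul, norm_mul, norm_pow, norm_pow, norm_exp_neg, Complex.norm_real,
      Real.norm_of_nonneg (Real.exp_nonneg _), Complex.norm_exp]
    simp
  · exact Eventually.of_forall fun θ _ => hsum.mul_right _
  · exact intervalIntegrable_const
  · refine Eventually.of_forall fun θ _ => (h _ ?_).mul_right _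
    rw [norm_exp_neg]
    simpa using ht

/-- Evaluation at the saddle t = √(A/n). With A = e^x and n = e^y all powers become exponentials of
linear forms in x and y. -/
theorem saddle_main_term {A n : ℝ} (hA : 0 < A) (hn : 0 < n) (l γ : ℝ) :
    l * Real.sqrt (A / n) ^ (γ / 2) * Real.exp (2 * A / Real.sqrt (A / n)) *
        (Real.sqrt (A / n) * Real.sqrt (Real.sqrt (A / n) / A)) * Real.sqrt Real.pi =
      2 * Real.pi * (l * A ^ ((1 + γ) / 4) / (2 * Real.sqrt Real.pi * n ^ ((3 + γ) / 4)) *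
        Real.exp (2 * Real.sqrt (A * n))) := by
  obtain ⟨x, rfl⟩ : ∃ x, Real.exp x = A := ⟨_, Real.exp_log hA⟩
  obtain ⟨y, rfl⟩ : ∃ y, Real.exp y = n := ⟨_, Real.exp_log hn⟩
  rw [← Real.exp_sub, ← Real.exp_half, ← Real.exp_sub, ← Real.exp_half, ← Real.exp_add,
    ← Real.exp_add x y, ← Real.exp_half, ← Real.exp_mul, ← Real.exp_mul, ← Real.exp_mul,
    mul_div_assoc, ← Real.exp_sub, show x - (x - y) / 2 = (x + y) / 2 by ring]
  have hπ := Real.sqrt_pos.mpr Real.pi_pos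
  have h1 : 2 * Real.pi = 2 * (Real.sqrt Real.pi * Real.sqrt Real.pi) := by
    rw [Real.mul_self_sqrt Real.pi_pos.le]
  have h2 : Real.exp ((x - y) / 2 * (γ / 2)) * Real.exp ((x - y) / 2 + ((x - y) / 2 - x) / 2) *
      Real.exp (y * ((3 + γ) / 4)) = Real.exp (x * ((1 + γ) / 4)) := by
    rw [← Real.exp_add, ← Real.exp_add]
    ring_nf
  rw [h1, ← h2]
  field_simp

/-- Meinardus-type asymptotics for the coefficients of a finite product of dilated partition
generating functions with coprime dilations. -/
theorem isEquivalent_coeff {S : Finset ℕ} {a : ℕ → ℕ} (hS : ∀ m ∈ S, 0 < m)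
    (ha : ∀ m ∈ S, a m ≠ 0) (hgcd : S.gcd id = 1) {c : ℕ → ℝ}
    (hc : ∀ q : ℂ, ‖q‖ < 1 →
      HasSum (fun n => (c n : ℂ) * q ^ n) (∏ m ∈ S, (eulerProd (q ^ m))⁻¹ ^ a m))
    {l γ A : ℝ} (hl : l = ∏ m ∈ S, ((m : ℝ) / (2 * Real.pi)) ^ ((a m : ℝ) / 2))
    (hγ : γ = ∑ m ∈ S, (a m : ℝ)) (hA : A = Real.pi ^ 2 * (∑ m ∈ S, (a m : ℝ) / m) / 6) :
    Asymptotics.IsEquivalent atTop c fun n : ℕ =>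
      l * A ^ ((1 + γ) / 4) / (2 * Real.sqrt Real.pi * (n : ℝ) ^ ((3 + γ) / 4)) *
        Real.exp (2 * Real.sqrt (A * (n : ℝ))) := by
  have hne : S.Nonempty := by
    rw [nonempty_iff_ne_empty]
    rintro rfl
    simp at hgcd
  have hm : ∀ m ∈ S, (0 : ℝ) < m := fun m h => by exact_mod_cast hS m h
  have hl0 : 0 < l := by
    rw [hl]
    exact Finset.prod_pos fun m h => Real.rpow_pos_of_pos
      (div_pos (hm m h) (by positivity)) _
  have hγ0 : 0 ≤ γ := by rw [hγ]; positivity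
  have hA0 : 0 < A := by
    have : 0 < ∑ m ∈ S, (a m : ℝ) / m := Finset.sum_pos (fun m h =>
      div_pos (by exact_mod_cast Nat.pos_of_ne_zero (ha m h)) (hm m h)) hne
    rw [hA]
    positivity
  have hasymp := tendsto_expGenFun_div S a hS
  rw [← hl, ← hγ, ← hA] at hasymp
  have hsaddle := tendsto_saddle hA0 (by positivity : 0 ≤ γ / 2) hl0 hasymp
    (continuousOn_expGenFun S a hS) (norm_expGenFun_le hS ha hgcd)
  -- t = √(A/n) is the saddle of A/z + nz; equivalently A/t² = n, so the weight in `tendsto_saddle`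
  -- becomes e^(nz).
  have htn : Tendsto (fun n : ℕ => Real.sqrt (A / n)) atTop (𝓝[>] 0) := by
    refine tendsto_nhdsWithin_iff.mpr ⟨?_, ?_⟩
    · simpa only [Real.sqrt_zero, Function.comp_def] using
        (Real.continuous_sqrt.tendsto 0).comp (tendsto_const_div_atTop_nhds_zero_nat A)
    · filter_upwards [eventually_gt_atTop 0] with n hn
      have : (0 : ℝ) < n := by exact_mod_cast hn
      exact Real.sqrt_pos.mpr (by positivity)
  have hπ := Real.sqrt_pos.mpr Real.pi_pos
  have h1 := (Complex.continuous_re.tendsto _).comp (hsaddle.comp htn)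
  have h2 := h1.div_const (Real.sqrt Real.pi)
  rw [Complex.ofReal_re, div_self hπ.ne'] at h2
  refine (Asymptotics.isEquivalent_iff_tendsto_one ?_).mpr (h2.congr' ?_)
  · filter_upwards [eventually_gt_atTop 0] with n hn
    have : (0 : ℝ) < n := by exact_mod_cast hn
    positivity
  · filter_upwards [eventually_gt_atTop 0] with n hn
    have hn' : (0 : ℝ) < n := by exact_mod_cast hn
    have ht : 0 < Real.sqrt (A / n) := Real.sqrt_pos.mpr (by positivity)
    have hsq : (A : ℂ) / ((Real.sqrt (A / n) : ℝ) : ℂ) ^ 2 = n := by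
      have : A / Real.sqrt (A / n) ^ 2 = n := by
        rw [Real.sq_sqrt (by positivity)]
        field_simp
      exact_mod_cast this
    have hint := integral_eq_coeff hc ht n
    simp only [Function.comp_apply, hsq]
    unfold expGenFun
    rw [hint]
    have hcast : ((2 : ℂ) * Real.pi * c n) = ((2 * Real.pi * c n : ℝ) : ℂ) := by push_cast; rfl
    rw [hcast, ← Complex.ofReal_div, Complex.ofReal_re, div_div, saddle_main_term hA0 hn',
      mul_div_mul_left _ _ (by positivity), Pi.div_apply]

/-! ### Reduction to coprime indices -/

theorem entry_succ {k : ℕ} (e : Fin k → ℤ) (i : Fin k) : entry e ((i : ℕ) + 1) = e i := by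
  have h : 1 ≤ (i : ℕ) + 1 ∧ (i : ℕ) + 1 ≤ k := ⟨by omega, i.2⟩
  simp [entry, h]

theorem entry_of_lt {k : ℕ} (e : Fin k → ℤ) {m : ℕ} (hm : k < m) : entry e m = 0 := by
  rw [entry, dif_neg]
  omega

theorem entry_nonneg {k : ℕ} {e : Fin k → ℤ} (h : ∀ i, 0 ≤ e i) (m : ℕ) : 0 ≤ entry e m := by
  rw [entry]
  split_ifs
  · exact h _
  · rfl

/-- The indices `m` with `e_m ≠ 0`. -/
def supp {k : ℕ} (e : Fin k → ℤ) : Finset ℕ := (Icc 1 k).filter fun m => entry e m ≠ 0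

/-- The indices `n` with `e_{dn} ≠ 0`. -/
def reducedSupp {k : ℕ} (e : Fin k → ℤ) : Finset ℕ :=
  (Icc 1 (k / d e)).filter fun n => entry e (d e * n) ≠ 0

section

variable {k : ℕ} {e : Fin k → ℤ}

theorem supp_nonempty (he : e ≠ 0) : (supp e).Nonempty := by
  obtain ⟨i, hi⟩ := Function.ne_iff.mp he
  refine ⟨i + 1, mem_filter.mpr ⟨mem_Icc.mpr ⟨by omega, i.2⟩, ?_⟩⟩
  rwa [entry_succ]

theorem d_dvd {m : ℕ} (hm : m ∈ supp e) : d e ∣ m := Finset.gcd_dvd (f := id) hm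

theorem d_pos (he : e ≠ 0) : 0 < d e := by
  obtain ⟨m, hm⟩ := supp_nonempty he
  exact Nat.pos_of_dvd_of_pos (d_dvd hm) (mem_Icc.mp (mem_filter.mp hm).1).1

theorem supp_eq_image (he : e ≠ 0) : supp e = (reducedSupp e).image (d e * ·) := by
  ext m
  simp only [mem_image]
  constructor
  · intro hm
    obtain ⟨n, rfl⟩ := d_dvd hm
    refine ⟨n, ?_, rfl⟩
    obtain ⟨h1, h2⟩ := mem_filter.mp hm
    rw [mem_Icc] at h1
    refine mem_filter.mpr ⟨mem_Icc.mpr ⟨Nat.pos_of_mul_pos_left h1.1, ?_⟩, h2⟩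
    rw [Nat.le_div_iff_mul_le (d_pos he), mul_comm]
    exact h1.2
  · rintro ⟨n, hn, rfl⟩
    obtain ⟨h1, h2⟩ := mem_filter.mp hn
    rw [mem_Icc, Nat.le_div_iff_mul_le (d_pos he), mul_comm] at h1
    exact mem_filter.mpr ⟨mem_Icc.mpr ⟨Nat.mul_pos (d_pos he) h1.1, h1.2⟩, h2⟩

theorem gcd_reducedSupp (he : e ≠ 0) : (reducedSupp e).gcd id = 1 := by
  have h : d e * (reducedSupp e).gcd id = d e * 1 := by
    have h1 : d e = (supp e).gcd id := rfl
    rw [supp_eq_image he, Finset.gcd_image] at h1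
    have h2 := Finset.gcd_mul_left (s := reducedSupp e) (f := id) (a := d e)
    rw [normalize_eq] at h2
    rw [mul_one, ← h2]
    exact h1.symm
  exact Nat.eq_of_mul_eq_mul_left (d_pos he) h

theorem prod_univ_eq_prod_reducedSupp {M : Type*} [CommMonoid M] (he : e ≠ 0) (g : ℕ → M) :
    ∏ i : Fin k, g ((i : ℕ) + 1) ^ (e i).toNat =
      ∏ n ∈ reducedSupp e, g (d e * n) ^ (entry e (d e * n)).toNat := by
  have h1 : ∏ i : Fin k, g ((i : ℕ) + 1) ^ (e i).toNat =
      ∏ i : Fin k, (fun j => g (j + 1) ^ (entry e (j + 1)).toNat) (i : ℕ) :=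
    Finset.prod_congr rfl fun i _ => by simp only [entry_succ]
  have h2 : ∏ m ∈ supp e, g m ^ (entry e m).toNat = ∏ m ∈ Icc 1 k, g m ^ (entry e m).toNat := by
    refine Finset.prod_subset (filter_subset _ _) fun m hm hm' => ?_
    have : entry e m = 0 := by
      by_contra h
      exact hm' (mem_filter.mpr ⟨hm, h⟩)
    rw [this, Int.toNat_zero, pow_zero]
  rw [h1, Fin.prod_univ_eq_prod_range (fun j => g (j + 1) ^ (entry e (j + 1)).toNat),
    Finset.range_eq_Ico, Finset.prod_Ico_add' (fun j => g j ^ (entry e j).toNat) 0 k 1, zero_add,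
    show Ico 1 (k + 1) = Icc 1 k from rfl, ← h2, supp_eq_image he, Finset.prod_image]
  exact fun x _ y _ h => Nat.eq_of_mul_eq_mul_left (d_pos he) h

theorem hasSum_p_mul (he : e ≠ 0) (hnonneg : ∀ i, 0 ≤ e i) {q : ℂ} (hq : ‖q‖ < 1) :
    HasSum (fun n => ((p e (d e * n) : ℝ) : ℂ) * q ^ n)
      (∏ n ∈ reducedSupp e, (eulerProd (q ^ n))⁻¹ ^ (entry e (d e * n)).toNat) := by
  have hd0 := d_pos he
  -- Any d-th root w of q will do: the series in w is supported on multiples of d, hence is a series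
  -- in w^d = q.
  obtain ⟨w, rfl⟩ := IsAlgClosed.exists_pow_nat_eq q hd0
  have hw : ‖w‖ < 1 := by
    rw [norm_pow] at hq
    exact (pow_lt_one_iff_of_nonneg (norm_nonneg w) hd0.ne').mp hq
  have hE : (fun i => ((e i).toNat : ℤ)) = e := funext fun i => Int.toNat_of_nonneg (hnonneg i)
  have h := hasNonnegExpansion_genFun (d e) (fun i => (e i).toNat) fun i hi => ?_
  · rw [hE] at h
    have hsum := h.hasSum w hw
    rw [prod_univ_eq_prod_reducedSupp he fun m => (eulerProd (w ^ m))⁻¹,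
      ← (mul_right_injective₀ hd0.ne').hasSum_iff] at hsum
    · simp only [← pow_mul]
      simpa [Function.comp_def, p] using hsum
    · intro n hn
      rw [h.coeff_eq_zero n, Int.cast_zero, zero_mul]
      rintro ⟨m, rfl⟩
      exact hn ⟨m, rfl⟩
  · refine d_dvd (mem_filter.mpr ⟨mem_Icc.mpr ⟨by omega, i.2⟩, ?_⟩)
    rw [entry_succ]
    rintro h0
    simp [h0] at hi

end

theorem isEquivalent_p {k : ℕ} {e : Fin k → ℤ} (he : e ≠ 0) (hnonneg : ∀ i, 0 ≤ e i) :
    Asymptotics.IsEquivalent atTop (fun n : ℕ => (p e (d e * n) : ℝ)) fun n : ℕ =>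
      lam e * A e ^ ((1 + gamma e) / 4) /
          (2 * Real.sqrt Real.pi * (n : ℝ) ^ ((3 + gamma e) / 4)) *
        Real.exp (2 * Real.sqrt (A e * (n : ℝ))) := by
  have hcast : ∀ m, ((entry e m).toNat : ℝ) = (entry e m : ℝ) := fun m => by
    exact_mod_cast congrArg (Int.cast (R := ℝ)) (Int.toNat_of_nonneg (entry_nonneg hnonneg m))
  have hzero : ∀ n, n ∈ Finset.Icc 1 (k / d e) → n ∉ reducedSupp e → entry e (d e * n) = 0 :=
    fun n hn hn' => by
      by_contra h
      exact hn' (Finset.mem_filter.mpr ⟨hn, h⟩)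
  refine isEquivalent_coeff (S := reducedSupp e) (a := fun n => (entry e (d e * n)).toNat)
    (fun m hm => (Finset.mem_Icc.mp (Finset.mem_filter.mp hm).1).1) (fun m hm => ?_)
    (gcd_reducedSupp he) (fun q hq => hasSum_p_mul he hnonneg hq) ?_ ?_ ?_
  · have h1 := (Finset.mem_filter.mp hm).2
    have h2 := entry_nonneg hnonneg (d e * m)
    omega
  · simp only [hcast]
    symm
    -- The product in `lam` runs to k rather than k / d; the extra indices have dm > k, where the
    -- entry is 0 by convention.
    refine Finset.prod_subset (fun m hm => ?_) fun m hm hm' => ?_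
    · have := Finset.mem_Icc.mp (Finset.mem_filter.mp hm).1
      exact Finset.mem_Icc.mpr ⟨this.1, this.2.trans (Nat.div_le_self _ _)⟩
    · have h0 : entry e (d e * m) = 0 := by
        rcases le_or_gt m (k / d e) with h | h
        · exact hzero m (Finset.mem_Icc.mpr ⟨(Finset.mem_Icc.mp hm).1, h⟩) hm'
        · refine entry_of_lt e ?_
          rwa [Nat.div_lt_iff_lt_mul (d_pos he), mul_comm] at h
      simp [h0]
  · simp only [hcast]
    symm
    exact Finset.sum_subset (Finset.filter_subset _ _) fun n hn hn' => by simp [hzero n hn hn']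
  · simp only [hcast]
    rw [A, delta]
    congr 2
    symm
    exact Finset.sum_subset (Finset.filter_subset _ _) fun n hn hn' => by simp [hzero n hn hn']

end GenPartition

end

theorem theorem1p1 (k : ℕ) (e : Fin k → ℤ) (he : e ≠ 0) (hnonneg : ∀ i, 0 ≤ e i) :
    Asymptotics.IsEquivalent Filter.atTop
      (fun n : ℕ => (GenPartition.p e (GenPartition.d e * n) : ℝ))
      (fun n : ℕ =>
        GenPartition.lam e * GenPartition.A e ^ ((1 + GenPartition.gamma e) / 4) /
            (2 * Real.sqrt Real.pi * (n : ℝ) ^ ((3 + GenPartition.gamma e) / 4)) *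
          Real.exp (2 * Real.sqrt (GenPartition.A e * (n : ℝ)))) :=
  GenPartition.isEquivalent_p he hnonneg
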